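/- **Setting.** Fix a set $\mathrm{AP}$ of atomic propositions with a distinguished element $\mathit{turn}$. A Markov decision process (MDP) has a countable set $S$ of states, a finite set $A$ of actions, for each state $s$ a nonempty set $\Gamma(s)\subseteq A$ of available actions, for each state $s$ and action $a$ a probability distribution $\delta(s,a)$ on $S$, and for each state a set of atomic propositions true there. Write $\mathrm{dest}(s,a)=\mathrm{supp}\,\delta(s,a)$. The MDP is finite if $S$ is finite, and finitely-branching if $\mathrm{dest}(s,a)$ is finite for all $s\in S$ and $a\in\Gamma(s)$. It is an alternating MDP (AMDP) if $S$ is partitioned into $S_1$ and $S_p$ (possibly empty) such that $\mathit{turn}$ holds at every $s\in S_1$ and $|\mathrm{dest}(s,a)|=1$ for all $a\in\Gamma(s)$, while $\mathit{turn}$ fails at every $s\in S_p$ and $|\Gamma(s)|=1$. A player-1 strategy $\sigma$ maps each nonempty finite sequence of states to a distribution on the actions available at its last state. A player-$p$ strategy $\tau$ maps each nonempty finite sequence of states and each action $a$ to a distribution on $S$, supported in $\mathrm{dest}(s,a)$ if $a\in\Gamma(s)$ for the last state $s$. $\mathrm{Outcome}(s,\sigma,\tau)$ is the set of infinite plays from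 $s$ each of whose steps results from an action and a successor that both have positive probability under $\sigma$ and $\tau$. $\Pr_s^\sigma$ is the law of the play from $s$ when player 1 uses $\sigma$ and successors are drawn from $\delta$. State formulas are $\mathrm{true}$, $q\in\mathrm{AP}$, $\neg\psi$, $\psi_1\vee\psi_2$, and $Q(\phi)$, where $Q$ is a path quantifier and $\phi$ is a state formula $\psi$ (evaluated at the first state of the play) or $\bigcirc\psi$, $\psi_1\,\mathcal U\,\psi_2$, $\psi_1\,\mathcal W\,\psi_2$ with state formulas $\psi,\psi_1,\psi_2$. Here $\bigcirc$ and $\mathcal U$ are the usual next and until operators, and $\psi_1\,\mathcal W\,\psi_2$ holds on a play if $\psi_1$ holds at all positions, or $\psi_2$ holds at some position $j$ and $\psi_1$ at all positions $i\le j$. Write $[\![\phi]\!]$ for the set of plays that satisfy $\phi$. * ATL has the quantifiers $\langle\!\langle 1\rangle\!\rangle$, $\langle\!\langle p\rangle\!\rangle$, $\langle\!\langle 1,p\rangle\!\rangle$, $\langle\!\langle\emptyset\rangle\!\rangle$: at $s$ they say that $\mathrm{Outcome}(s,\sigma,\tau)\subseteq[\![\phi]\!]$ holds, respectively, for some $\sigma$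 and all $\tau$; for some $\tau$ and all $\sigma$; for some $\sigma$ and some $\tau$; for all $\sigma$ and all $\tau$. * $\mathrm{QRCTL}^{>0}$ has the quantifiers $\exists^{>0}$, $\forall^{>0}$: at $s$ they say that $\Pr_s^\sigma([\![\phi]\!])>0$ for some $\sigma$, respectively for all $\sigma$. Let $\approx_{\mathrm{ATL}}$ (respectively $\approx^{>0}$) be the relation on $S$ that relates two states of an MDP iff they satisfy the same ATL formulas (respectively the same $\mathrm{QRCTL}^{>0}$ formulas). **Theorem.** 1. On every finite AMDP, $\approx_{\mathrm{ATL}}\ \subseteq\ \approx^{>0}$. 2. There is a finite MDP, which is not alternating, on which $\approx_{\mathrm{ATL}}\ \not\subseteq\ \approx^{>0}$. 3. There is an infinite, but finitely-branching, AMDP on which $\approx_{\mathrm{ATL}}\ \not\subseteq\ \approx^{>0}$. -/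

import Mathlib

open scoped ENNReal

noncomputable section

/-- A Markov decision process with atomic propositions `AP`, a countable set `S` of states and a
finite set `A` of actions. -/
structure MDP (AP S A : Type*) where
  countable_states : Countable S
  finite_actions : Finite A
  /-- the actions that can be chosen at a state -/
  mov : S → Set A
  mov_nonempty : ∀ s, (mov s).Nonempty
  /-- the next-state distributions -/
  trans : S → A → PMF S
  /-- the atomic propositions that are true at a state -/
  label : S → Set AP

namespace MDP

variable {AP S A : Type*}

/-- The possible destinations when `a` is chosen at `s`. -/
def dest (G : MDP AP S A) (s : S) (a : A) : Set S :=
  (G.trans s a).support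

/-- Every available action has finitely many possible destinations. -/
def IsFinitelyBranching (G : MDP AP S A) : Prop :=
  ∀ s, ∀ a ∈ G.mov s, (G.dest s a).Finite

/-- `G` is an alternating MDP with respect to the distinguished proposition `turn`: the states are
partitioned into player-1 states `S₁`, which satisfy `turn` and where every action has a unique
destination, and probabilistic states `Sₚ`, which do not satisfy `turn` and where there is a
unique action. Either part may be empty. -/
def IsAlternating (G : MDP AP S A) (turn : AP) : Prop :=
  ∃ S₁ Sₚ : Set S, Disjoint S₁ Sₚ ∧ S₁ ∪ Sₚ = Set.univ ∧
    (∀ s ∈ S₁, turn ∈ G.label s ∧ ∀ a ∈ G.mov s, (G.dest s a).ncard = 1) ∧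
    (∀ s ∈ Sₚ, turn ∉ G.label s ∧ (G.mov s).ncard = 1)

/-! ### Strategies

A nonempty finite sequence of states is given by the list of its states except the last one, in
chronological order, together with the last one (the current state). -/

/-- A (randomized, history-dependent) strategy of player 1. -/
structure Strategy₁ (G : MDP AP S A) where
  choose : List S → S → PMF A
  support_subset : ∀ h s, (choose h s).support ⊆ G.mov s

/-- A (randomized, history-dependent) strategy of player p, who also sees the action that player 1
has just chosen. -/
structure Strategyₚ (G : MDP AP S A) where
  choose : List S → S → A → PMF S
  support_subset : ∀ h s, ∀ a ∈ G.mov s, (choose h s a).support ⊆ G.dest s a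

/-- The strategy of player p that follows the transition probabilities of the MDP. -/
def natural (G : MDP AP S A) : G.Strategyₚ where
  choose _ s a := G.trans s a
  support_subset _ _ _ _ := subset_rfl

/-- The feasible plays that start from `s`, given strategies of both players. -/
def outcome (G : MDP AP S A) (s : S) (σ : G.Strategy₁) (τ : G.Strategyₚ) : Set (ℕ → S) :=
  {ω | ω 0 = s ∧ ∀ k, ∃ a ∈ G.mov (ω k),
    0 < σ.choose (List.ofFn fun i : Fin k => ω i) (ω k) a ∧
    0 < τ.choose (List.ofFn fun i : Fin k => ω i) (ω k) a (ω (k + 1))}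

/-- The distribution of the next state after the history `h` with current state `s`. -/
def nextState (G : MDP AP S A) (σ : G.Strategy₁) (τ : G.Strategyₚ) (h : List S) (s : S) : PMF S :=
  (σ.choose h s).bind fun a => τ.choose h s a

/-- `nextState` as a Markov kernel from the first `n + 1` states of a play to the next state; the
state space carries the discrete σ-algebra. -/
def stepKernel (G : MDP AP S A) (σ : G.Strategy₁) (τ : G.Strategyₚ) (n : ℕ) :
    @ProbabilityTheory.Kernel (∀ _ : Finset.Iic n, S) S
      (@MeasurableSpace.pi _ _ fun _ => ⊤) ⊤ :=
  letI : MeasurableSpace S := ⊤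
  haveI : Countable S := G.countable_states
  haveI : DiscreteMeasurableSpace S := ⟨fun _ => trivial⟩
  { toFun := fun x =>
      (G.nextState σ τ (List.ofFn fun i : Fin n => x ⟨i, Finset.mem_Iic.2 i.2.le⟩)
        (x ⟨n, Finset.mem_Iic.2 le_rfl⟩)).toMeasure
    measurable' := Measurable.of_discrete }

theorem isMarkovKernel_stepKernel (G : MDP AP S A) (σ : G.Strategy₁) (τ : G.Strategyₚ) (n : ℕ) :
    @ProbabilityTheory.IsMarkovKernel _ _ (@MeasurableSpace.pi _ _ fun _ => ⊤) ⊤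
      (G.stepKernel σ τ n) :=
  letI : MeasurableSpace S := ⊤
  ⟨fun _ => PMF.toMeasure.isProbabilityMeasure _⟩

/-- The law of the play that starts at `s` under the strategies `σ` and `τ`: the measure on the
product σ-algebra of `ℕ → S` built from the one-step kernels (Ionescu-Tulcea). -/
def playMeasure (G : MDP AP S A) (s : S) (σ : G.Strategy₁) (τ : G.Strategyₚ) :
    @MeasureTheory.Measure (ℕ → S) (@MeasurableSpace.pi _ _ fun _ => ⊤) :=
  letI : MeasurableSpace S := ⊤
  haveI := G.isMarkovKernel_stepKernel σ τ
  ProbabilityTheory.Kernel.traj (X := fun _ => S) (G.stepKernel σ τ) 0 fun _ => s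

/-- The probability of an event under strategies of both players. -/
def prob (G : MDP AP S A) (s : S) (σ : G.Strategy₁) (τ : G.Strategyₚ) (E : Set (ℕ → S)) : ℝ≥0∞ :=
  @DFunLike.coe _ (Set (ℕ → S)) (fun _ => ℝ≥0∞)
    (@MeasureTheory.Measure.instFunLike (ℕ → S) (@MeasurableSpace.pi _ _ fun _ => ⊤))
    (G.playMeasure s σ τ) E

end MDP

/-- State formulas over the atomic propositions `AP` and the path quantifiers `Q` in which every
temporal operator is immediately preceded by a path quantifier. (A path formula without a temporal
operator outside path quantifiers is itself a state formula, which gives the clause `quant`.) -/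
inductive StateFormula (AP Q : Type*) where
  | tru : StateFormula AP Q
  | atom : AP → StateFormula AP Q
  | neg : StateFormula AP Q → StateFormula AP Q
  | or : StateFormula AP Q → StateFormula AP Q → StateFormula AP Q
  /-- `Q ψ` for a state formula `ψ` -/
  | quant : Q → StateFormula AP Q → StateFormula AP Q
  /-- `Q (○ ψ)` -/
  | next : Q → StateFormula AP Q → StateFormula AP Q
  /-- `Q (ψ₁ U ψ₂)` -/
  | until : Q → StateFormula AP Q → StateFormula AP Q → StateFormula AP Q
  /-- `Q (ψ₁ W ψ₂)` -/
  | wait : Q → StateFormula AP Q → StateFormula AP Q → StateFormula AP Q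

/-- The path quantifiers `⟪1⟫`, `⟪p⟫`, `⟪1,p⟫` and `⟪∅⟫` of ATL. -/
inductive ATLQuantifier where
  | one
  | p
  | oneP
  | none

/-- The path quantifiers `∃^{>0}` and `∀^{>0}` of the fragment QRCTL^{>0} of QRCTL. -/
inductive PosQuantifier where
  | existsPos
  | forallPos

namespace MDP

variable {AP S A Q : Type*}

/-- The satisfaction relation, for an interpretation `sem` of the path quantifiers as properties
of a state and a set of plays. -/
def Sat (G : MDP AP S A) (sem : Q → S → Set (ℕ → S) → Prop) : StateFormula AP Q → S → Prop
  | .tru, _ => True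
  | .atom q, s => q ∈ G.label s
  | .neg ψ, s => ¬ G.Sat sem ψ s
  | .or ψ₁ ψ₂, s => G.Sat sem ψ₁ s ∨ G.Sat sem ψ₂ s
  | .quant q ψ, s => sem q s {ω | G.Sat sem ψ (ω 0)}
  | .next q ψ, s => sem q s {ω | G.Sat sem ψ (ω 1)}
  | .until q ψ₁ ψ₂, s =>
      sem q s {ω | ∃ j, G.Sat sem ψ₂ (ω j) ∧ ∀ i < j, G.Sat sem ψ₁ (ω i)}
  | .wait q ψ₁ ψ₂, s =>
      sem q s {ω | (∀ j, G.Sat sem ψ₁ (ω j)) ∨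
        ∃ j, G.Sat sem ψ₂ (ω j) ∧ ∀ i ≤ j, G.Sat sem ψ₁ (ω i)}

/-- The semantics of the ATL quantifiers, in the 2-player interpretation. -/
def atlSem (G : MDP AP S A) : ATLQuantifier → S → Set (ℕ → S) → Prop
  | .one, s, E => ∃ σ : G.Strategy₁, ∀ τ : G.Strategyₚ, G.outcome s σ τ ⊆ E
  | .p, s, E => ∃ τ : G.Strategyₚ, ∀ σ : G.Strategy₁, G.outcome s σ τ ⊆ E
  | .oneP, s, E => ∃ σ : G.Strategy₁, ∃ τ : G.Strategyₚ, G.outcome s σ τ ⊆ E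
  | .none, s, E => ∀ σ : G.Strategy₁, ∀ τ : G.Strategyₚ, G.outcome s σ τ ⊆ E

/-- The semantics of the quantifiers of QRCTL^{>0}, in the 1½-player interpretation, where
player p follows the transition probabilities. -/
def posSem (G : MDP AP S A) : PosQuantifier → S → Set (ℕ → S) → Prop
  | .existsPos, s, E => ∃ σ : G.Strategy₁, 0 < G.prob s σ G.natural E
  | .forallPos, s, E => ∀ σ : G.Strategy₁, 0 < G.prob s σ G.natural E

/-- The equivalence of states induced by all ATL formulas. -/
def atlEquiv (G : MDP AP S A) : Set (S × S) :=
  {x | ∀ ψ : StateFormula AP ATLQuantifier, G.Sat G.atlSem ψ x.1 ↔ G.Sat G.atlSem ψ x.2}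

/-- The equivalence of states `≈^{>0}` induced by all formulas of QRCTL^{>0}. -/
def posEquiv (G : MDP AP S A) : Set (S × S) :=
  {x | ∀ ψ : StateFormula AP PosQuantifier, G.Sat G.posSem ψ x.1 ↔ G.Sat G.posSem ψ x.2}

end MDP

end

open scoped MeasureTheory NNReal

noncomputable section

/-! ### The law of a play on cylinders and the Markov property -/

namespace MDP

variable {AP S A : Type*}

/-! On a finite AMDP, every `QRCTL^{>0}` formula defines a set of states that some ATL formula also
defines (`atlDefinable_sat_posSem`). For next and until, positive probability is witnessed by a
finite path, so only supports matter: `∃^{>0}` becomes `⟪1,p⟫` and `∀^{>0}` becomes `⟪p⟫`. The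
converse direction is determinacy (`not_atlSem_until_iff`): if the coalition fails, its opponents
surely enforce the complement, which then has probability one for some, or for every, σ.

Weak until rests on a maximum principle (`PMF.eq_of_le_tsum_mul`): where the probability of success
is maximal and `C` is not yet reached, it is also maximal at all successors. For `∃^{>0}` this shows
that positive probability means reaching, through `B`, a state where player 1 is surely safe
(`posSem_existsPos_wait`). For `∀^{>0}` the truth set is a fixpoint of `R ↦ ⟪p⟫(B U ⟪∅⟫(B W (R ∪
C)))`; alternation lets player 1 avoid `R` while still using every action that can leave `R`
(`mem_of_forallPos_wait`). Finiteness provides the maxima and makes the fixpoint definable.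

For the counterexamples, ATL is blind to whatever a bisimulation of the two-player game ignores
(`mem_atlEquiv`). In `gadget` this is the exact support of an action that combines risk and safety;
in `chain` it is the numerical probabilities, with infinite products of survival chances that vanish
in one chain and not in the other. -/

/-- The product σ-algebra on plays over a discrete state space. -/
abbrev playSpace (S : Type*) : MeasurableSpace (ℕ → S) := @MeasurableSpace.pi _ _ fun _ => ⊤

/-- Prepend a state to a play. -/
def consPlay (s : S) (ω : ℕ → S) : ℕ → S
  | 0 => s
  | n + 1 => ω n

theorem measurable_consPlay (s : S) : Measurable[playSpace S, playSpace S] (consPlay s) := by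
  let _ : MeasurableSpace S := ⊤
  refine measurable_pi_iff.2 fun n => ?_
  cases n with
  | zero => exact measurable_const
  | succ n => exact measurable_pi_apply n

/-- The plays that agree with `x` up to time `n`. -/
def cyl (x : ℕ → S) (n : ℕ) : Set (ℕ → S) := {ω | ∀ i ≤ n, ω i = x i}

theorem measurableSet_eval (i : ℕ) (Z : Set S) : MeasurableSet[playSpace S] {ω | ω i ∈ Z} := by
  let _ : MeasurableSpace S := ⊤
  exact measurable_pi_apply (X := fun _ : ℕ => S) i (MeasurableSpace.measurableSet_top (s := Z))

theorem measurableSet_cyl (x : ℕ → S) (n : ℕ) : MeasurableSet[playSpace S] (cyl x n) := by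
  let _ : MeasurableSpace S := ⊤
  have : cyl x n = ⋂ i, ⋂ (_ : i ≤ n), {ω | ω i ∈ ({x i} : Set S)} := by
    ext ω; simp [cyl]
  rw [this]
  exact MeasurableSet.iInter fun i => MeasurableSet.iInter fun _ => measurableSet_eval i _

/-- Finite measures on plays that agree on cylinders are equal. -/
theorem measure_ext_cyl [Countable S] (μ ν : @MeasureTheory.Measure (ℕ → S) (playSpace S))
    [@MeasureTheory.IsFiniteMeasure _ (playSpace S) μ]
    (h : ∀ x n, μ (cyl x n) = ν (cyl x n)) : μ = ν := by
  let _ : MeasurableSpace S := ⊤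
  have _ : DiscreteMeasurableSpace S := ⟨fun _ => trivial⟩
  -- The law of an initial segment lives on a countable set, and its atoms are the cylinders.
  have key : ∀ n, ν.map (Preorder.frestrictLe n) = μ.map (Preorder.frestrictLe n) := by
    intro n
    refine MeasureTheory.Measure.ext_of_singleton fun y => ?_
    rw [MeasureTheory.Measure.map_apply (by fun_prop) (measurableSet_singleton y),
      MeasureTheory.Measure.map_apply (by fun_prop) (measurableSet_singleton y)]
    have : (Preorder.frestrictLe (π := fun _ => S) n) ⁻¹' {y} =
        cyl (fun i => y ⟨min i n, by simp⟩) n := by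
      ext ω
      simp only [Set.mem_preimage, Set.mem_singleton_iff, funext_iff, Subtype.forall,
        Preorder.frestrictLe_apply, cyl, Set.mem_ofPred_eq, Finset.mem_Iic]
      refine forall_congr' fun i => forall_congr' fun hi => ?_
      simp only [min_eq_left hi]
    rw [this, h]
  have hμ : MeasureTheory.IsProjectiveLimit μ (fun I : Finset ℕ => μ.map I.restrict) :=
    fun _ => rfl
  refine hμ.unique (((MeasureTheory.isProjectiveLimit_nat_iff ?_ ν).2) key)
  intro I J hJI
  rw [MeasureTheory.Measure.map_map (by fun_prop) (by fun_prop)]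
  rfl

variable (G : MDP AP S A)

theorem playMeasure_isProbabilityMeasure (s : S) (σ : G.Strategy₁) (τ : G.Strategyₚ) :
    @MeasureTheory.IsProbabilityMeasure _ (playSpace S) (G.playMeasure s σ τ) := by
  let _ : MeasurableSpace S := ⊤
  have := G.isMarkovKernel_stepKernel σ τ
  unfold playMeasure
  infer_instance

theorem prob_cyl_zero (s : S) (σ : G.Strategy₁) (τ : G.Strategyₚ) (x : ℕ → S) [Decidable (s = x 0)] :
    G.prob s σ τ (cyl x 0) = if s = x 0 then 1 else 0 := by
  let _ : MeasurableSpace S := ⊤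
  have _ : Countable S := G.countable_states
  have _ : DiscreteMeasurableSpace S := ⟨fun _ => trivial⟩
  have := G.isMarkovKernel_stepKernel σ τ
  unfold prob playMeasure
  have h := ProbabilityTheory.Kernel.traj_map_frestrictLe_apply
    (X := fun _ => S) (κ := G.stepKernel σ τ) 0 0 (fun _ => s)
  have h2 := congrArg (fun μ => μ {fun i : Finset.Iic 0 => x i}) h
  simp only [ProbabilityTheory.Kernel.partialTraj_self, ProbabilityTheory.Kernel.id_apply] at h2
  rw [MeasureTheory.Measure.map_apply (by fun_prop) (measurableSet_singleton _)] at h2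
  convert h2 using 1
  · congr 1
    ext ω
    simp [cyl, funext_iff]
  · rw [MeasureTheory.Measure.dirac_apply]
    by_cases hs : s = x 0 <;> simp [hs, Set.indicator, funext_iff]

/-- The law of the first `n + 2` states is the composition-product of the law of the first `n + 1`
with the step kernel; this evaluates it at an atom. -/
theorem prob_cyl_succ (s : S) (σ : G.Strategy₁) (τ : G.Strategyₚ) (x : ℕ → S) (n : ℕ) :
    G.prob s σ τ (cyl x (n + 1)) = G.prob s σ τ (cyl x n) *
      G.nextState σ τ (List.ofFn fun i : Fin n => x i) (x n) (x (n + 1)) := by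
  let _ : MeasurableSpace S := ⊤
  have _ : Countable S := G.countable_states
  have _ : DiscreteMeasurableSpace S := ⟨fun _ => trivial⟩
  have := G.isMarkovKernel_stepKernel σ τ
  unfold prob playMeasure
  have h := ProbabilityTheory.Kernel.partialTraj_compProd_eq_map_traj
    (X := fun _ => S) (κ := G.stepKernel σ τ) (Nat.zero_le n) (x₀ := fun _ => s)
  have h2 := congrArg (fun μ => μ ({Preorder.frestrictLe n x} ×ˢ {x (n + 1)})) h
  rw [MeasureTheory.Measure.compProd_apply_prod (measurableSet_singleton _)
    (measurableSet_singleton _), MeasureTheory.lintegral_singleton,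
    ← ProbabilityTheory.Kernel.traj_map_frestrictLe_apply,
    MeasureTheory.Measure.map_apply (by fun_prop) (measurableSet_singleton _),
    MeasureTheory.Measure.map_apply (by fun_prop)
      ((measurableSet_singleton _).prod (measurableSet_singleton _))] at h2
  have e1 : (fun ω : ℕ → S => (Preorder.frestrictLe (π := fun _ => S) n ω, ω (n + 1))) ⁻¹'
      ({Preorder.frestrictLe n x} ×ˢ {x (n + 1)}) = cyl x (n + 1) := by
    ext ω
    simp only [Set.mem_preimage, Set.mem_prod, Set.mem_singleton_iff, funext_iff, Subtype.forall,
      Preorder.frestrictLe_apply, Finset.mem_Iic, cyl, Set.mem_ofPred_eq]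
    constructor
    · rintro ⟨h, h'⟩ i hi
      rcases Nat.le_succ_iff.1 hi with hi | rfl
      exacts [h i hi, h']
    · exact fun h => ⟨fun i hi => h i (by omega), h _ le_rfl⟩
  have e2 : (Preorder.frestrictLe (π := fun _ => S) n) ⁻¹' {Preorder.frestrictLe n x} =
      cyl x n := by
    ext ω
    simp [funext_iff, cyl]
  rw [e1, e2, mul_comm] at h2
  rw [← h2]
  congr 1
  exact PMF.toMeasure_apply_singleton _ _ (measurableSet_singleton (α := S) _)

variable {G} in
/-- The strategy that `σ` plays after the first state `s` of a play. -/
def Strategy₁.shift (σ : G.Strategy₁) (s : S) : G.Strategy₁ where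
  choose h := σ.choose (s :: h)
  support_subset h := σ.support_subset (s :: h)

/-- The Markov property at the first step. -/
theorem prob_eq_tsum (s : S) (σ : G.Strategy₁) {E : Set (ℕ → S)}
    (hE : MeasurableSet[playSpace S] E) :
    G.prob s σ G.natural E = ∑' t, G.nextState σ G.natural [] s t *
      G.prob t (σ.shift s) G.natural (consPlay s ⁻¹' E) := by
  classical
  let _ : MeasurableSpace S := ⊤
  have _ : Countable S := G.countable_states
  have hp := G.playMeasure_isProbabilityMeasure s σ G.natural
  -- Draw the second state, run the shifted strategy from it and prepend `s`; this law is compared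
  -- with the play measure on cylinders.
  let ν : MeasureTheory.Measure (ℕ → S) := MeasureTheory.Measure.sum fun t =>
    G.nextState σ G.natural [] s t • (G.playMeasure t (σ.shift s) G.natural).map (consPlay s)
  have hν : ∀ F, MeasurableSet F → ν F = ∑' t, G.nextState σ G.natural [] s t *
      G.prob t (σ.shift s) G.natural (consPlay s ⁻¹' F) := by
    intro F hF
    rw [MeasureTheory.Measure.sum_apply _ hF]
    refine tsum_congr fun t => ?_
    rw [MeasureTheory.Measure.smul_apply, MeasureTheory.Measure.map_apply
      (measurable_consPlay s) hF]
    rfl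
  suffices h : G.playMeasure s σ G.natural = ν by
    rw [← hν E hE, ← h]; rfl
  refine measure_ext_cyl _ _ fun x n => ?_
  rw [hν _ (measurableSet_cyl x n)]
  change G.prob s σ G.natural _ = _
  have hpre : ∀ n, s = x 0 → consPlay s ⁻¹' cyl x (n + 1) = cyl (fun i => x (i + 1)) n := by
    intro n h
    ext ω
    constructor
    · exact fun hω i hi => hω (i + 1) (by omega)
    · rintro hω (_ | i) hi
      exacts [h, hω i (by omega)]
  by_cases hs : s = x 0
  swap
  · have h0 : G.prob s σ G.natural (cyl x n) = 0 := by
      refine le_antisymm ?_ zero_le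
      calc G.prob s σ G.natural (cyl x n) ≤ G.prob s σ G.natural (cyl x 0) :=
            MeasureTheory.measure_mono fun ω hω i hi => hω i (by omega)
        _ = 0 := by rw [prob_cyl_zero, if_neg hs]
    have h1 : consPlay s ⁻¹' cyl x n = ∅ :=
      Set.eq_empty_of_forall_notMem fun ω hω => hs (hω 0 (Nat.zero_le n))
    rw [h0, h1]
    simp [prob]
  cases n with
  | zero =>
    have h1 : consPlay s ⁻¹' cyl x 0 = Set.univ := by
      ext ω; simp [cyl, hs, consPlay]
    rw [prob_cyl_zero, if_pos hs, h1]
    have : ∀ t, G.prob t (σ.shift s) G.natural Set.univ = 1 := fun t =>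
      (G.playMeasure_isProbabilityMeasure t (σ.shift s) G.natural).measure_univ
    simp [this, PMF.tsum_coe]
  | succ n =>
    rw [hpre n hs]
    induction n with
    | zero =>
      rw [prob_cyl_succ, prob_cyl_zero, if_pos hs]
      simp_rw [prob_cyl_zero]
      simp [tsum_ite_eq, ← hs]
    | succ n ih =>
      rw [prob_cyl_succ, ih]
      simp_rw [prob_cyl_succ G _ _ _ _ n, ← mul_assoc]
      rw [ENNReal.tsum_mul_right, List.ofFn_succ]
      simp only [Fin.val_zero, ← hs]
      rfl

end MDP

namespace MDP

variable {AP S A : Type*}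

/-! ### Plays of positive probability -/

/-- The plays that stay in `B` until they reach `C`. -/
def untilSet (B C : Set S) : Set (ℕ → S) := {ω | ∃ j, ω j ∈ C ∧ ∀ i < j, ω i ∈ B}

/-- The plays that stay in `B` forever or up to and including a visit of `C`. -/
def waitSet (B C : Set S) : Set (ℕ → S) :=
  {ω | (∀ j, ω j ∈ B) ∨ ∃ j, ω j ∈ C ∧ ∀ i ≤ j, ω i ∈ B}

theorem measurableSet_untilSet (B C : Set S) : MeasurableSet[playSpace S] (untilSet B C) := by
  let _ := playSpace S
  have : untilSet B C = ⋃ j, ({ω | ω j ∈ C} ∩ ⋂ i, ⋂ (_ : i < j), {ω | ω i ∈ B}) := by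
    ext ω; simp [untilSet]
  rw [this]
  exact MeasurableSet.iUnion fun j => (measurableSet_eval j C).inter <|
    MeasurableSet.iInter fun i => MeasurableSet.iInter fun _ => measurableSet_eval i B

theorem measurableSet_waitSet (B C : Set S) : MeasurableSet[playSpace S] (waitSet B C) := by
  let _ := playSpace S
  have : waitSet B C = (⋂ j, {ω | ω j ∈ B}) ∪
      ⋃ j, ({ω | ω j ∈ C} ∩ ⋂ i, ⋂ (_ : i ≤ j), {ω | ω i ∈ B}) := by
    ext ω; simp [waitSet]
  rw [this]
  exact (MeasurableSet.iInter fun j => measurableSet_eval j B).union <|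
    MeasurableSet.iUnion fun j => (measurableSet_eval j C).inter <|
    MeasurableSet.iInter fun i => MeasurableSet.iInter fun _ => measurableSet_eval i B

theorem compl_untilSet (B C : Set S) : (untilSet B C)ᶜ = waitSet Cᶜ Bᶜ := by
  classical
  ext ω
  simp only [untilSet, waitSet, Set.mem_compl_iff, Set.mem_ofPred_eq, not_exists, not_and]
  constructor
  · intro h
    by_cases hB : ∀ j, ω j ∈ B
    · exact Or.inl fun j hj => h j hj fun i _ => hB i
    · simp only [not_forall] at hB
      -- Up to and including the first exit from `B`, a visit of `C` would complete the until.
      refine Or.inr ⟨Nat.find hB, Nat.find_spec hB, fun i hi hC => h i hC fun k hk => ?_⟩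
      exact not_not.1 (Nat.find_min hB (hk.trans_le hi))
  · rintro (h | ⟨j, hj, h⟩) k hk hB
    · exact h k hk
    · rcases lt_or_ge j k with hjk | hjk
      exacts [hj (hB j hjk), h k hjk hk]

theorem consPlay_mem_untilSet {B C : Set S} {s : S} {ω : ℕ → S} (hs : s ∈ B)
    (h : ω ∈ untilSet B C) : consPlay s ω ∈ untilSet B C := by
  obtain ⟨j, hj, h⟩ := h
  refine ⟨j + 1, hj, ?_⟩
  rintro (_ | i) hi
  exacts [hs, h i (by omega)]

theorem consPlay_mem_waitSet {B C : Set S} {s : S} {ω : ℕ → S} (hs : s ∈ B)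
    (h : ω ∈ waitSet B C) : consPlay s ω ∈ waitSet B C := by
  rcases h with h | ⟨j, hj, h⟩
  · left
    rintro (_ | i)
    exacts [hs, h i]
  · refine Or.inr ⟨j + 1, hj, ?_⟩
    rintro (_ | i) hi
    exacts [hs, h i (by omega)]

theorem of_consPlay_mem_waitSet {B C : Set S} {s : S} {ω : ℕ → S} (hs : s ∉ C)
    (h : consPlay s ω ∈ waitSet B C) : ω ∈ waitSet B C := by
  rcases h with h | ⟨_ | j, hj, h⟩
  · exact Or.inl fun j => h (j + 1)
  · exact absurd hj hs
  · exact Or.inr ⟨j, hj, fun i hi => h (i + 1) (by omega)⟩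

variable (G : MDP AP S A)

theorem prob_univ (s : S) (σ : G.Strategy₁) (τ : G.Strategyₚ) : G.prob s σ τ Set.univ = 1 :=
  (G.playMeasure_isProbabilityMeasure s σ τ).measure_univ

theorem prob_mono (s : S) (σ : G.Strategy₁) (τ : G.Strategyₚ) {E F : Set (ℕ → S)} (h : E ⊆ F) :
    G.prob s σ τ E ≤ G.prob s σ τ F := by
  let _ := playSpace S
  exact MeasureTheory.measure_mono h

theorem prob_le_one (s : S) (σ : G.Strategy₁) (τ : G.Strategyₚ) (E : Set (ℕ → S)) :
    G.prob s σ τ E ≤ 1 :=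
  (G.prob_mono s σ τ (Set.subset_univ E)).trans_eq (G.prob_univ s σ τ)

theorem mem_support_nextState {σ : G.Strategy₁} {τ : G.Strategyₚ} {h : List S} {s t : S} :
    t ∈ (G.nextState σ τ h s).support ↔
      ∃ a ∈ G.mov s, 0 < σ.choose h s a ∧ 0 < τ.choose h s a t := by
  rw [nextState, PMF.mem_support_bind_iff]
  simp only [PMF.mem_support_iff, pos_iff_ne_zero]
  exact ⟨fun ⟨a, ha, hat⟩ => ⟨a, σ.support_subset h s ((PMF.mem_support_iff _ _).2 ha), ha, hat⟩,
    fun ⟨a, _, ha, hat⟩ => ⟨a, ha, hat⟩⟩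

theorem mem_outcome {s : S} {σ : G.Strategy₁} {τ : G.Strategyₚ} {ω : ℕ → S} :
    ω ∈ G.outcome s σ τ ↔ ω 0 = s ∧ ∀ k, ω (k + 1) ∈
      (G.nextState σ τ (List.ofFn fun i : Fin k => ω i) (ω k)).support := by
  simp only [mem_support_nextState]
  rfl

/-- The natural strategy has full support, so a play obtained against any `τ` is also feasible for
the MDP itself. -/
theorem outcome_subset_natural (s : S) (σ : G.Strategy₁) (τ : G.Strategyₚ) :
    G.outcome s σ τ ⊆ G.outcome s σ G.natural := by
  rintro ω ⟨h0, h⟩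
  refine ⟨h0, fun k => ?_⟩
  obtain ⟨a, ha, hσ, hτ⟩ := h k
  exact ⟨a, ha, hσ, pos_iff_ne_zero.2 ((PMF.mem_support_iff _ _).1
    (τ.support_subset _ _ a ha ((PMF.mem_support_iff _ _).2 hτ.ne')))⟩

theorem outcome_natural_shift {s : S} {σ : G.Strategy₁} {ω : ℕ → S}
    (h : ω ∈ G.outcome s σ G.natural) :
    (fun i => ω (i + 1)) ∈ G.outcome (ω 1) (σ.shift s) G.natural := by
  refine ⟨rfl, fun k => ?_⟩
  have := h.2 (k + 1)
  rw [List.ofFn_succ] at this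
  simp only [Fin.val_zero, h.1] at this
  exact this

/-- Almost every play is feasible. -/
theorem prob_compl_outcome (s : S) (σ : G.Strategy₁) (τ : G.Strategyₚ) :
    G.prob s σ τ (G.outcome s σ τ)ᶜ = 0 := by
  classical
  let _ := playSpace S
  have _ : Countable S := G.countable_states
  -- Freezing a finite word at its last state names cylinders by countably many words; `N k`
  -- collects those whose last step is impossible.
  let ext (k : ℕ) (y : Fin (k + 1) → S) : ℕ → S := fun i => y ⟨min i k, by omega⟩
  let N (k : ℕ) : Set (ℕ → S) := ⋃ y : {y : Fin (k + 2) → S //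
    G.nextState σ τ (List.ofFn fun i : Fin k => ext (k + 1) y i) (ext (k + 1) y k)
      (ext (k + 1) y (k + 1)) = 0}, cyl (ext (k + 1) y) (k + 1)
  have hN : ∀ k, G.prob s σ τ (N k) = 0 := by
    refine fun k => MeasureTheory.measure_iUnion_null fun y => ?_
    change G.prob s σ τ _ = 0
    rw [prob_cyl_succ, y.2, mul_zero]
  have h0 : G.prob s σ τ (⋃ t : {t // s ≠ t}, cyl (fun _ => t) 0) = 0 := by
    refine MeasureTheory.measure_iUnion_null fun t => ?_
    change G.prob s σ τ _ = 0
    rw [prob_cyl_zero, if_neg t.2]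
  have hsub : (G.outcome s σ τ)ᶜ ⊆
      (⋃ t : {t // s ≠ t}, cyl (fun _ => (t : S)) 0) ∪ ⋃ k, N k := by
    intro ω hω
    rw [Set.mem_compl_iff, mem_outcome, not_and_or, not_forall] at hω
    rcases hω with hω | ⟨k, hω⟩
    · refine Or.inl (Set.mem_iUnion.2 ⟨⟨ω 0, Ne.symm hω⟩, fun i hi => ?_⟩)
      rw [Nat.le_zero.1 hi]
    · rw [PMF.mem_support_iff, not_not] at hω
      have hx : ∀ i ≤ k + 1, ext (k + 1) (fun i => ω i) i = ω i := fun i hi => by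
        simp only [ext, min_eq_left hi]
      refine Or.inr (Set.mem_iUnion.2 ⟨k, Set.mem_iUnion.2
        ⟨⟨fun i => ω i, ?_⟩, fun i hi => (hx i hi).symm⟩⟩)
      rw [hx k (by omega), hx (k + 1) le_rfl]
      convert hω using 4
      exact funext fun i => hx _ (by omega)
  refine le_antisymm ((G.prob_mono s σ _ hsub).trans ?_) zero_le
  exact (MeasureTheory.measure_union_null h0 (MeasureTheory.measure_iUnion_null hN)).le

/-- A set of full measure is nonempty, so no play has to be constructed. -/
theorem outcome_nonempty (s : S) (σ : G.Strategy₁) (τ : G.Strategyₚ) :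
    (G.outcome s σ τ).Nonempty := by
  by_contra h
  have h0 := G.prob_compl_outcome s σ τ
  rw [Set.not_nonempty_iff_eq_empty.1 h, Set.compl_empty, prob_univ] at h0
  exact one_ne_zero h0

theorem prob_eq_one {s : S} {σ : G.Strategy₁} {E : Set (ℕ → S)}
    (h : G.outcome s σ G.natural ⊆ E) : G.prob s σ G.natural E = 1 := by
  let _ := playSpace S
  refine le_antisymm (G.prob_le_one s σ _ E) ?_
  calc 1 = G.prob s σ G.natural Set.univ := (G.prob_univ s σ _).symm
    _ ≤ G.prob s σ G.natural (E ∪ (G.outcome s σ G.natural)ᶜ) :=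
      G.prob_mono s σ _ fun ω _ => (em (ω ∈ G.outcome s σ G.natural)).imp (@h ω) id
    _ ≤ G.prob s σ G.natural E + G.prob s σ G.natural (G.outcome s σ G.natural)ᶜ :=
      MeasureTheory.measure_union_le _ _
    _ = G.prob s σ G.natural E := by rw [prob_compl_outcome, add_zero]

theorem prob_eq_zero {s : S} {σ : G.Strategy₁} {E : Set (ℕ → S)}
    (h : G.outcome s σ G.natural ⊆ Eᶜ) : G.prob s σ G.natural E = 0 := by
  refine le_antisymm ?_ zero_le
  rw [← G.prob_compl_outcome s σ G.natural]
  exact G.prob_mono s σ _ (Set.subset_compl_comm.1 h)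

theorem prob_pos_of_succ {s t : S} {σ : G.Strategy₁} {E F : Set (ℕ → S)}
    (hE : MeasurableSet[playSpace S] E) (ht : t ∈ (G.nextState σ G.natural [] s).support)
    (hF : ∀ ω ∈ F, consPlay s ω ∈ E) (hpos : 0 < G.prob t (σ.shift s) G.natural F) :
    0 < G.prob s σ G.natural E := by
  rw [prob_eq_tsum G s σ hE, pos_iff_ne_zero, Ne, ENNReal.tsum_eq_zero]
  intro h
  rcases mul_eq_zero.1 (h t) with h | h
  · exact ht h
  · exact (hpos.trans_le (G.prob_mono t _ _ hF)).ne' h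

/-- If an event has positive probability, whatever player 1 does, from some state that a feasible
play reaches through `B`, then it has positive probability from the start. -/
theorem prob_pos_of_path {B : Set S} {E : Set (ℕ → S)} (hE : MeasurableSet[playSpace S] E)
    (hB : ∀ s ∈ B, ∀ ω ∈ E, consPlay s ω ∈ E) (j : ℕ) :
    ∀ {s : S} {σ : G.Strategy₁} {ω : ℕ → S}, ω ∈ G.outcome s σ G.natural → (∀ i < j, ω i ∈ B) →
      (∀ σ', 0 < G.prob (ω j) σ' G.natural E) → 0 < G.prob s σ G.natural E := by
  induction j with
  | zero => exact fun hω _ h => hω.1 ▸ h _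
  | succ j ih =>
    intro s σ ω hω hi h
    have hs : s ∈ B := hω.1 ▸ hi 0 (by omega)
    have h0 := ((G.mem_outcome).1 hω).2 0
    rw [hω.1, List.ofFn_zero] at h0
    exact G.prob_pos_of_succ hE h0 (hB s hs)
      (ih (G.outcome_natural_shift hω) (fun i hij => hi (i + 1) (by omega)) h)

/-- Play the action `a` in the first round and continue with `σ`. -/
def Strategy₁.prepend {G : MDP AP S A} (s : S) (a : A) (ha : a ∈ G.mov s) (σ : G.Strategy₁) :
    G.Strategy₁ where
  choose
    | [], x => open Classical in if x = s then PMF.pure a else σ.choose [] x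
    | _ :: h, x => σ.choose h x
  support_subset := by
    rintro (_ | ⟨y, h⟩) x
    · simp only
      split_ifs with hx
      · subst hx; simpa using ha
      · exact σ.support_subset _ _
    · exact σ.support_subset _ _

theorem exists_prob_pos_of_succ {s t : S} {a : A} {σ : G.Strategy₁} {E : Set (ℕ → S)}
    (hE : MeasurableSet[playSpace S] E) (ha : a ∈ G.mov s) (ht : t ∈ G.dest s a)
    (hs : ∀ ω ∈ E, consPlay s ω ∈ E) (hpos : 0 < G.prob t σ G.natural E) :
    ∃ σ' : G.Strategy₁, 0 < G.prob s σ' G.natural E := by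
  refine ⟨σ.prepend s a ha, G.prob_pos_of_succ hE (t := t) ?_ hs hpos⟩
  rw [mem_support_nextState]
  exact ⟨a, ha, by simp [Strategy₁.prepend], pos_iff_ne_zero.2 ht⟩

end MDP

/-- The quantifier for the opposite coalition. -/
def ATLQuantifier.dual : ATLQuantifier → ATLQuantifier
  | .one => .p
  | .p => .one
  | .oneP => .none
  | .none => .oneP

@[simp] theorem ATLQuantifier.dual_dual (q : ATLQuantifier) : q.dual.dual = q := by
  cases q <;> rfl

namespace MDP

variable {AP S A : Type*} (G : MDP AP S A)

/-! ### Fixpoint characterization of the ATL quantifiers -/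

/-- The states from which the coalition `q` can force the next state into `Z`. -/
def cpre : ATLQuantifier → Set S → Set S
  | .one, Z => {s | ∃ a ∈ G.mov s, ∀ t ∈ G.dest s a, t ∈ Z}
  | .p, Z => {s | ∀ a ∈ G.mov s, ∃ t ∈ G.dest s a, t ∈ Z}
  | .oneP, Z => {s | ∃ a ∈ G.mov s, ∃ t ∈ G.dest s a, t ∈ Z}
  | .none, Z => {s | ∀ a ∈ G.mov s, ∀ t ∈ G.dest s a, t ∈ Z}

theorem cpre_mono (q : ATLQuantifier) {Y Z : Set S} (h : Y ⊆ Z) : G.cpre q Y ⊆ G.cpre q Z := by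
  cases q
  · exact fun s ⟨a, ha, hs⟩ => ⟨a, ha, fun t ht => h (hs t ht)⟩
  · exact fun s hs a ha => (hs a ha).imp fun t ht => ⟨ht.1, h ht.2⟩
  · exact fun s ⟨a, ha, t, ht, hs⟩ => ⟨a, ha, t, ht, h hs⟩
  · exact fun s hs a ha t ht => h (hs a ha t ht)

/-- One round is determined: player p answers after seeing the action, so the two sides are De
Morgan duals. -/
theorem compl_cpre (q : ATLQuantifier) (Z : Set S) : (G.cpre q Z)ᶜ = G.cpre q.dual Zᶜ := by
  ext s
  cases q <;> simp [cpre, ATLQuantifier.dual]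

theorem dest_nonempty (s : S) (a : A) : (G.dest s a).Nonempty := (G.trans s a).support_nonempty

/-- The strategy that chooses the action `f s` at `s`. -/
def pureStrategy₁ (f : S → A) (hf : ∀ s, f s ∈ G.mov s) : G.Strategy₁ where
  choose _ s := PMF.pure (f s)
  support_subset _ s := by simpa using hf s

/-- The strategy that chooses the successor `g s a` when `a` is played at `s`. -/
def pureStrategyₚ (g : S → A → S) (hg : ∀ s a, g s a ∈ G.dest s a) : G.Strategyₚ where
  choose _ s a := PMF.pure (g s a)
  support_subset _ s a _ := by simpa using hg s a

theorem eq_of_pure_pos {α : Type*} {a b : α} (h : 0 < PMF.pure a b) : b = a := by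
  by_contra hne
  simp [PMF.pure_apply, hne] at h

/-- A memoryless strategy of the coalition `q` forces the next state into `F s` from every state
`s` where this is possible. -/
theorem atlSem_of_forall (q : ATLQuantifier) {s : S} (F : S → Set S) {E : Set (ℕ → S)}
    (h : ∀ ω : ℕ → S, ω 0 = s → (∀ k, ω k ∈ G.cpre q (F (ω k)) → ω (k + 1) ∈ F (ω k)) → ω ∈ E) :
    G.atlSem q s E := by
  classical
  -- Aim at `F s` when `a` permits it, otherwise take any legal successor.
  have hg : ∀ s a, ∃ t ∈ G.dest s a, (∃ t ∈ G.dest s a, t ∈ F s) → t ∈ F s := by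
    intro s a
    by_cases h' : ∃ t ∈ G.dest s a, t ∈ F s
    · exact h'.imp fun t ht => ⟨ht.1, fun _ => ht.2⟩
    · exact (G.dest_nonempty s a).imp fun t ht => ⟨ht, fun h => absurd h h'⟩
  have hf : ∀ P : S → A → Prop, ∃ f : S → A, ∀ s, f s ∈ G.mov s ∧
      ((∃ a ∈ G.mov s, P s a) → P s (f s)) := by
    intro P
    refine Classical.axiomOfChoice (r := fun s a => a ∈ G.mov s ∧
      ((∃ a ∈ G.mov s, P s a) → P s a)) fun s => ?_
    by_cases h' : ∃ a ∈ G.mov s, P s a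
    · exact h'.imp fun a ha => ⟨ha.1, fun _ => ha.2⟩
    · exact (G.mov_nonempty s).imp fun a ha => ⟨ha, fun h => absurd h h'⟩
  choose g hg hgF using hg
  have hdest : ∀ {τ : G.Strategyₚ} {l : List S} {s t : S} {a : A}, a ∈ G.mov s →
      0 < τ.choose l s a t → t ∈ G.dest s a :=
    fun {τ} _ _ _ _ ha ht => τ.support_subset _ _ _ ha ht.ne'
  cases q with
  | one =>
    obtain ⟨f, hf⟩ := hf fun s a => ∀ t ∈ G.dest s a, t ∈ F s
    refine ⟨G.pureStrategy₁ f fun s => (hf s).1, fun τ ω hω => h ω hω.1 fun k hk => ?_⟩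
    obtain ⟨a, ha, hσ, hτ⟩ := hω.2 k
    obtain rfl := eq_of_pure_pos hσ
    exact (hf (ω k)).2 hk _ (hdest ha hτ)
  | p =>
    refine ⟨G.pureStrategyₚ g hg, fun σ ω hω => h ω hω.1 fun k hk => ?_⟩
    obtain ⟨a, ha, hσ, hτ⟩ := hω.2 k
    rw [show ω (k + 1) = _ from eq_of_pure_pos hτ]
    exact hgF _ _ (hk a ha)
  | oneP =>
    obtain ⟨f, hf⟩ := hf fun s a => ∃ t ∈ G.dest s a, t ∈ F s
    refine ⟨G.pureStrategy₁ f fun s => (hf s).1, G.pureStrategyₚ g hg,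
      fun ω hω => h ω hω.1 fun k hk => ?_⟩
    obtain ⟨a, ha, hσ, hτ⟩ := hω.2 k
    obtain rfl := eq_of_pure_pos hσ
    rw [show ω (k + 1) = _ from eq_of_pure_pos hτ]
    exact hgF _ _ ((hf (ω k)).2 hk)
  | none =>
    refine fun σ τ ω hω => h ω hω.1 fun k hk => ?_
    obtain ⟨a, ha, hσ, hτ⟩ := hω.2 k
    exact hk a ha _ (hdest ha hτ)

/-- Winning strategies of opposed coalitions would share an outcome, lying both in `E` and outside
it. -/
theorem not_atlSem_dual_compl {q : ATLQuantifier} {s : S} {E : Set (ℕ → S)}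
    (h : G.atlSem q s E) : ¬ G.atlSem q.dual s Eᶜ := by
  intro h'
  cases q with
  | one =>
    obtain ⟨σ, hσ⟩ := h
    obtain ⟨τ, hτ⟩ := h'
    obtain ⟨ω, hω⟩ := G.outcome_nonempty s σ τ
    exact hτ σ hω (hσ τ hω)
  | p =>
    obtain ⟨σ, hσ⟩ := h'
    obtain ⟨τ, hτ⟩ := h
    obtain ⟨ω, hω⟩ := G.outcome_nonempty s σ τ
    exact hσ τ hω (hτ σ hω)
  | oneP =>
    obtain ⟨σ, τ, h⟩ := h
    obtain ⟨ω, hω⟩ := G.outcome_nonempty s σ τ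
    exact h' σ τ hω (h hω)
  | none =>
    obtain ⟨σ, τ, h'⟩ := h'
    obtain ⟨ω, hω⟩ := G.outcome_nonempty s σ τ
    exact h' hω (h σ τ hω)

theorem atlSem_eval_zero (q : ATLQuantifier) (Z : Set S) (s : S) :
    G.atlSem q s {ω | ω 0 ∈ Z} ↔ s ∈ Z := by
  have key : ∀ q (Z : Set S), s ∈ Z → G.atlSem q s {ω | ω 0 ∈ Z} := fun q Z hs =>
    G.atlSem_of_forall q (fun _ => Set.univ) fun ω h0 _ => show ω 0 ∈ Z from h0 ▸ hs
  refine ⟨fun h => ?_, key q Z⟩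
  by_contra hs
  exact G.not_atlSem_dual_compl h (key _ Zᶜ hs)

theorem atlSem_next (q : ATLQuantifier) (Z : Set S) (s : S) :
    G.atlSem q s {ω | ω 1 ∈ Z} ↔ s ∈ G.cpre q Z := by
  have key : ∀ q Z, s ∈ G.cpre q Z → G.atlSem q s {ω | ω 1 ∈ Z} := fun q Z hs =>
    G.atlSem_of_forall q (fun _ => Z) fun ω h0 hω => hω 0 (h0 ▸ hs)
  refine ⟨fun h => ?_, key q Z⟩
  by_contra hs
  exact G.not_atlSem_dual_compl h (key _ Zᶜ (G.compl_cpre q Z ▸ hs))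

/-- The states from which the coalition `q` can force a visit of `C` through `B` in at most `n`
rounds. -/
def reach (q : ATLQuantifier) (B C : Set S) : ℕ → Set S
  | 0 => C
  | n + 1 => C ∪ (B ∩ G.cpre q (reach q B C n))

theorem reach_mono (q : ATLQuantifier) (B C : Set S) : Monotone (G.reach q B C) := by
  refine monotone_nat_of_le_succ fun n => ?_
  induction n with
  | zero => exact Set.subset_union_left
  | succ n ih =>
    exact Set.union_subset_union_right _ (Set.inter_subset_inter_right _ (G.cpre_mono q ih))

theorem atlSem_until_of_mem_reach {q : ATLQuantifier} {B C : Set S} {n : ℕ} {s : S}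
    (hs : s ∈ G.reach q B C n) : G.atlSem q s (untilSet B C) := by
  classical
  -- Aim one rank lower, the rank being the least `n` with `s` in the `n`-th stage. At rank `0` the
  -- truncated subtraction is harmless, as `C` is already reached.
  let F : S → Set S := fun s =>
    if h : ∃ n, s ∈ G.reach q B C n then G.reach q B C (Nat.find h - 1) else Set.univ
  refine G.atlSem_of_forall q F fun ω h0 hω => ?_
  rw [← h0] at hs
  clear h0
  induction n using Nat.strong_induction_on generalizing ω with
  | _ n ih =>
    have hex : ∃ n, ω 0 ∈ G.reach q B C n := ⟨n, hs⟩
    have hle := Nat.find_min' hex hs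
    have hfind := Nat.find_spec hex
    by_cases hC : ω 0 ∈ C
    · exact ⟨0, hC, by simp⟩
    obtain ⟨m, hm⟩ : ∃ m, Nat.find hex = m + 1 := Nat.exists_eq_succ_of_ne_zero fun h => by
      rw [h] at hfind
      exact hC hfind
    rw [hm] at hfind hle
    obtain ⟨hB, hpre⟩ := hfind.resolve_left hC
    have hF : F (ω 0) = G.reach q B C m := by
      simp only [F, dif_pos hex, hm, Nat.add_sub_cancel]
    have h1 := hω 0
    rw [hF] at h1
    have := ih m hle (fun i => ω (i + 1)) (h1 hpre) (fun k => hω (k + 1))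
    convert consPlay_mem_untilSet hB this using 1
    ext (_ | i) <;> rfl

/-- Coinduction: `q` keeps the play inside `Z` until its first visit of `C`, if there is one. -/
theorem atlSem_wait_of_mem {q : ATLQuantifier} {B C Z : Set S} (hB : Z ⊆ B)
    (hC : Z ⊆ C ∪ G.cpre q Z) {s : S} (hs : s ∈ Z) : G.atlSem q s (waitSet B C) := by
  classical
  refine G.atlSem_of_forall q (fun _ => Z) fun ω h0 hω => ?_
  have key : ∀ k, (∀ i < k, ω i ∉ C) → ω k ∈ Z := by
    intro k
    induction k with
    | zero => exact fun _ => h0 ▸ hs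
    | succ k ih =>
      exact fun h => hω k ((hC (ih fun i hi => h i (by omega))).resolve_left (h k (by omega)))
  by_cases hex : ∃ j, ω j ∈ C
  · exact Or.inr ⟨Nat.find hex, Nat.find_spec hex, fun i hi =>
      hB (key i fun k hk => Nat.find_min hex (hk.trans_le hi))⟩
  · exact Or.inl fun j => hB (key j fun i _ hi => hex ⟨i, hi⟩)

theorem exists_forall_of_finite {α : Type*} {D : Set α} (hD : D.Finite) {Z : ℕ → Set α}
    (hZ : Monotone Z) (h : ∀ x ∈ D, ∃ n, x ∈ Z n) : ∃ n, ∀ x ∈ D, x ∈ Z n := by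
  choose! f hf using h
  obtain ⟨n, hn⟩ := (hD.image f).bddAbove
  exact ⟨n, fun x hx => hZ (hn ⟨x, hx, rfl⟩) (hf x hx)⟩

/-- Finitely many actions and destinations have a common stage. This continuity makes the iteration
`reach` close at stage ω. -/
theorem cpre_iUnion_subset (hG : G.IsFinitelyBranching) (q : ATLQuantifier) {Z : ℕ → Set S}
    (hZ : Monotone Z) : G.cpre q (⋃ n, Z n) ⊆ ⋃ n, G.cpre q (Z n) := by
  have hA := G.finite_actions
  intro s hs
  rw [Set.mem_iUnion]
  cases q with
  | one =>
    obtain ⟨a, ha, hs⟩ := hs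
    obtain ⟨n, hn⟩ := exists_forall_of_finite (hG s a ha) hZ fun t ht => Set.mem_iUnion.1 (hs t ht)
    exact ⟨n, a, ha, hn⟩
  | p =>
    exact exists_forall_of_finite (G.mov s).toFinite
      (Z := fun n => {a | ∃ t ∈ G.dest s a, t ∈ Z n})
      (fun m n hmn a ⟨t, ht, h⟩ => ⟨t, ht, hZ hmn h⟩)
      (fun a ha => let ⟨t, ht, h⟩ := hs a ha; let ⟨n, hn⟩ := Set.mem_iUnion.1 h; ⟨n, t, ht, hn⟩)
  | oneP =>
    obtain ⟨a, ha, t, ht, h⟩ := hs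
    obtain ⟨n, hn⟩ := Set.mem_iUnion.1 h
    exact ⟨n, a, ha, t, ht, hn⟩
  | none =>
    exact exists_forall_of_finite (G.mov s).toFinite
      (Z := fun n => {a | ∀ t ∈ G.dest s a, t ∈ Z n})
      (fun m n hmn a h t ht => hZ hmn (h t ht))
      (fun a ha => exists_forall_of_finite (hG s a ha) hZ
        fun t ht => Set.mem_iUnion.1 (hs a ha t ht))

/-- Outside all stages of `reach`, the opponents can stay outside as long as the play is in `B`, and
`C` is never met there. -/
theorem atlSem_dual_of_forall_notMem_reach (hG : G.IsFinitelyBranching) {q : ATLQuantifier}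
    {B C : Set S} {s : S} (hs : ∀ n, s ∉ G.reach q B C n) :
    G.atlSem q.dual s (untilSet B C)ᶜ := by
  rw [compl_untilSet]
  refine G.atlSem_wait_of_mem (Z := (⋃ n, G.reach q B C n)ᶜ) ?_ ?_ (by simpa using hs)
  · exact Set.compl_subset_compl.2 (Set.subset_iUnion (G.reach q B C) 0)
  · rw [← compl_cpre, ← Set.compl_inter]
    refine Set.compl_subset_compl.2 fun t ht => ?_
    obtain ⟨n, hn⟩ := Set.mem_iUnion.1 (G.cpre_iUnion_subset hG q (G.reach_mono q B C) ht.2)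
    exact Set.mem_iUnion.2 ⟨n + 1, Or.inr ⟨ht.1, hn⟩⟩

theorem atlSem_until_iff (hG : G.IsFinitelyBranching) {q : ATLQuantifier} {B C : Set S} {s : S} :
    G.atlSem q s (untilSet B C) ↔ ∃ n, s ∈ G.reach q B C n := by
  refine ⟨fun h => ?_, fun ⟨n, hn⟩ => G.atlSem_until_of_mem_reach hn⟩
  by_contra hs
  exact G.not_atlSem_dual_compl h
    (G.atlSem_dual_of_forall_notMem_reach hG fun n hn => hs ⟨n, hn⟩)

/-- The games with an until objective are determined. -/
theorem not_atlSem_until_iff (hG : G.IsFinitelyBranching) {q : ATLQuantifier} {B C : Set S}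
    {s : S} : ¬ G.atlSem q s (untilSet B C) ↔ G.atlSem q.dual s (untilSet B C)ᶜ := by
  refine ⟨fun h => G.atlSem_dual_of_forall_notMem_reach hG fun n hn =>
    h (G.atlSem_until_of_mem_reach hn), fun h h' => G.not_atlSem_dual_compl h' h⟩

theorem atlSem_wait_iff (hG : G.IsFinitelyBranching) {q : ATLQuantifier} {B C : Set S}
    {s : S} : G.atlSem q s (waitSet B C) ↔ ¬ G.atlSem q.dual s (untilSet Cᶜ Bᶜ) := by
  rw [not_atlSem_until_iff G hG, ATLQuantifier.dual_dual, compl_untilSet, compl_compl, compl_compl]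

theorem atlSem_until_of_cpre (hG : G.IsFinitelyBranching) {q : ATLQuantifier} {B C : Set S}
    {s : S} (hB : s ∈ B) (h : s ∈ G.cpre q {t | G.atlSem q t (untilSet B C)}) :
    G.atlSem q s (untilSet B C) := by
  have h' : {t | G.atlSem q t (untilSet B C)} = ⋃ n, G.reach q B C n := by
    ext t
    simp [atlSem_until_iff G hG]
  rw [h'] at h
  obtain ⟨n, hn⟩ := Set.mem_iUnion.1 (G.cpre_iUnion_subset hG q (G.reach_mono q B C) h)
  exact (G.atlSem_until_iff hG).2 ⟨n + 1, Or.inr ⟨hB, hn⟩⟩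

theorem atlSem_until_of_mem {q : ATLQuantifier} {B C : Set S} {s : S} (hC : s ∈ C) :
    G.atlSem q s (untilSet B C) :=
  G.atlSem_until_of_mem_reach (n := 0) hC

end MDP

/-- If the average of `p` is at least its upper bound `M`, then `p` equals `M` on the support. -/
theorem PMF.eq_of_le_tsum_mul {α : Type*} (μ : PMF α) {p : α → ℝ≥0∞} {M : ℝ≥0∞} (hM : M ≠ ∞)
    (hp : ∀ t ∈ μ.support, p t ≤ M) (h : M ≤ ∑' t, μ t * p t) : ∀ t ∈ μ.support, p t = M := by
  intro t ht
  by_contra hne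
  have hlt : p t < M := lt_of_le_of_ne (hp t ht) hne
  have hle : ∀ t, μ t * p t ≤ μ t * M := fun t => by
    by_cases ht : t ∈ μ.support
    · exact mul_le_mul_right (hp t ht) _
    · rw [(μ.apply_eq_zero_iff t).2 ht, zero_mul, zero_mul]
  have hsum : ∑' t, μ t * M = M := by rw [ENNReal.tsum_mul_right, μ.tsum_coe, one_mul]
  refine absurd h (not_le.2 ?_)
  calc ∑' t, μ t * p t < ∑' t, μ t * M := by
        refine ENNReal.tsum_lt_tsum (i := t) ?_ hle ?_
        · exact ne_top_of_le_ne_top hM ((ENNReal.tsum_le_tsum hle).trans_eq hsum)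
        · exact (ENNReal.mul_lt_mul_iff_right ht (μ.apply_ne_top t)).2 hlt
    _ = M := hsum

/-- The ATL quantifier that corresponds to a quantifier of QRCTL^{>0} on reachability goals. -/
def PosQuantifier.toATL : PosQuantifier → ATLQuantifier
  | .existsPos => .oneP
  | .forallPos => .p

namespace MDP

variable {AP S A : Type*} (G : MDP AP S A)

/-! ### Reachability goals -/

/-- The opponents' win holds in particular against, or with, the natural strategy, under which `E`
is then null. -/
theorem not_posSem_of_atlSem {q : PosQuantifier} {s : S} {E : Set (ℕ → S)}
    (h : G.atlSem q.toATL.dual s Eᶜ) : ¬ G.posSem q s E := by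
  cases q with
  | existsPos => exact fun ⟨σ, hσ⟩ => hσ.ne' (G.prob_eq_zero (h σ G.natural))
  | forallPos =>
    obtain ⟨σ, hσ⟩ := h
    exact fun h' => (h' σ).ne' (G.prob_eq_zero (hσ G.natural))

/-- An ATL win is needed only for one feasible play in `E`; `hF` turns that play into positive
probability. -/
theorem posSem_of_atlSem {q : PosQuantifier} {s : S} {E F : Set (ℕ → S)}
    (h : G.atlSem q.toATL s E)
    (hF : ∀ σ, ∀ ω ∈ G.outcome s σ G.natural, ω ∈ E → 0 < G.prob s σ G.natural F) :
    G.posSem q s F := by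
  cases q with
  | existsPos =>
    obtain ⟨σ, τ, h⟩ := h
    obtain ⟨ω, hω⟩ := G.outcome_nonempty s σ τ
    exact ⟨σ, hF σ ω (G.outcome_subset_natural s σ τ hω) (h hω)⟩
  | forallPos =>
    obtain ⟨τ, h⟩ := h
    intro σ
    obtain ⟨ω, hω⟩ := G.outcome_nonempty s σ τ
    exact hF σ ω (G.outcome_subset_natural s σ τ hω) (h σ hω)

theorem prob_eval_zero {Z : Set S} {s : S} (hs : s ∈ Z) (σ : G.Strategy₁) :
    G.prob s σ G.natural {ω | ω 0 ∈ Z} = 1 :=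
  G.prob_eq_one fun ω hω => show ω 0 ∈ Z from hω.1 ▸ hs

theorem posSem_eval_zero (q : PosQuantifier) (Z : Set S) (s : S) :
    G.posSem q s {ω | ω 0 ∈ Z} ↔ s ∈ Z := by
  refine ⟨fun h => ?_, fun h => ?_⟩
  · by_contra hs
    exact G.not_posSem_of_atlSem ((G.atlSem_eval_zero _ Zᶜ s).2 hs) h
  · refine G.posSem_of_atlSem ((G.atlSem_eval_zero _ Z s).2 h) fun σ _ _ _ => ?_
    rw [G.prob_eval_zero h]
    exact one_pos

theorem posSem_next (q : PosQuantifier) (Z : Set S) (s : S) :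
    G.posSem q s {ω | ω 1 ∈ Z} ↔ G.atlSem q.toATL s {ω | ω 1 ∈ Z} := by
  refine ⟨fun h => ?_, fun h => G.posSem_of_atlSem h fun σ ω hω hZ => ?_⟩
  · by_contra hs
    rw [atlSem_next, ← Set.mem_compl_iff, compl_cpre, ← atlSem_next] at hs
    exact G.not_posSem_of_atlSem hs h
  · have h0 := (G.mem_outcome.1 hω).2 0
    rw [hω.1, List.ofFn_zero] at h0
    refine G.prob_pos_of_succ (measurableSet_eval 1 Z) h0 (F := {ω | ω 0 ∈ Z}) (fun _ h => h) ?_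
    exact one_pos.trans_eq (G.prob_eval_zero (Z := Z) hZ _).symm

theorem posSem_until (hG : G.IsFinitelyBranching) (q : PosQuantifier) (B C : Set S) (s : S) :
    G.posSem q s (untilSet B C) ↔ G.atlSem q.toATL s (untilSet B C) := by
  refine ⟨fun h => ?_, fun h => G.posSem_of_atlSem h fun σ ω hω hE => ?_⟩
  · by_contra hs
    exact G.not_posSem_of_atlSem ((G.not_atlSem_until_iff hG).1 hs) h
  · obtain ⟨j, hj, h⟩ := hE
    refine G.prob_pos_of_path (measurableSet_untilSet B C)
      (fun s hs ω => consPlay_mem_untilSet hs) j hω h fun σ' => ?_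
    rw [G.prob_eq_one fun ω' hω' => show ω' ∈ untilSet B C from ⟨0, hω'.1 ▸ hj, by simp⟩]
    exact one_pos

/-! ### Safety goals -/

theorem mem_of_prob_wait_pos {B C : Set S} {s : S} {σ : G.Strategy₁}
    (h : 0 < G.prob s σ G.natural (waitSet B C)) : s ∈ B := by
  by_contra hs
  refine h.ne' (G.prob_eq_zero fun ω hω => ?_)
  rintro (h | ⟨j, -, h⟩)
  · exact hs (hω.1 ▸ h 0)
  · exact hs (hω.1 ▸ h 0 (Nat.zero_le j))

/-- The submean inequality behind the maximum principle. With `s ∈ C` it could fail, as success at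
`s` says nothing about what follows. -/
theorem prob_wait_le {B C : Set S} {s : S} (σ : G.Strategy₁) (hs : s ∉ C) :
    G.prob s σ G.natural (waitSet B C) ≤ ∑' t, G.nextState σ G.natural [] s t *
      G.prob t (σ.shift s) G.natural (waitSet B C) := by
  rw [prob_eq_tsum G s σ (measurableSet_waitSet B C)]
  exact ENNReal.tsum_le_tsum fun t => mul_le_mul_right
    (G.prob_mono t _ _ fun ω hω => of_consPlay_mem_waitSet hs hω) _

theorem existsPos_wait_of_until (hG : G.IsFinitelyBranching) {B C : Set S} {s : S}
    (h : G.atlSem .oneP s (untilSet B {t | G.atlSem .one t (waitSet B C)})) :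
    G.posSem .existsPos s (waitSet B C) := by
  obtain ⟨n, hn⟩ := (G.atlSem_until_iff hG).1 h
  clear h
  have h0 : ∀ s, G.atlSem .one s (waitSet B C) → G.posSem .existsPos s (waitSet B C) := by
    rintro s ⟨σ, hσ⟩
    refine ⟨σ, ?_⟩
    rw [G.prob_eq_one (hσ G.natural)]
    exact one_pos
  induction n generalizing s with
  | zero => exact h0 s hn
  | succ n ih =>
    rcases hn with hn | ⟨hB, a, ha, t, ht, hn⟩
    · exact h0 s hn
    · obtain ⟨σ, hσ⟩ := ih hn
      exact G.exists_prob_pos_of_succ (measurableSet_waitSet B C) ha ht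
        (fun ω => consPlay_mem_waitSet hB) hσ

theorem isFinitelyBranching_of_finite [Finite S] : G.IsFinitelyBranching :=
  fun _ _ _ => Set.toFinite _

/-- Suppose the set `X` where the right side fails contains a state of positive value. At a state of
`X` with maximal value, a best action keeps the play among such states until `C`, so player 1 is
surely safe there and the state is not in `X`. -/
theorem posSem_existsPos_wait [Finite S] (B C : Set S) (s : S) :
    G.posSem .existsPos s (waitSet B C) ↔
      G.atlSem .oneP s (untilSet B {t | G.atlSem .one t (waitSet B C)}) := by
  have hG := G.isFinitelyBranching_of_finite
  refine ⟨fun ⟨σ₀, hσ₀⟩ => ?_, G.existsPos_wait_of_until hG⟩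
  by_contra hs
  have _ := G.finite_actions
  let X : Set S := {t | ¬ G.atlSem .oneP t (untilSet B {t | G.atlSem .one t (waitSet B C)})}
  let p (t : S) : ℝ≥0∞ := ⨆ σ : G.Strategy₁, G.prob t σ G.natural (waitSet B C)
  have hle : ∀ t σ, G.prob t σ G.natural (waitSet B C) ≤ p t := fun t σ =>
    le_iSup (fun σ : G.Strategy₁ => G.prob t σ G.natural (waitSet B C)) σ
  obtain ⟨m, hmX, hm⟩ := Set.exists_max_image X p X.toFinite ⟨s, hs⟩
  have hpos : 0 < p m := hσ₀.trans_le ((hle s σ₀).trans (hm s hs))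
  have htop : p m ≠ ∞ := ne_top_of_le_ne_top ENNReal.one_ne_top
    (iSup_le fun σ => G.prob_le_one m σ _ _)
  have hXB : ∀ t, p t = p m → t ∈ B := fun t ht => by
    rw [← ht] at hpos
    obtain ⟨σ, hσ⟩ := lt_iSup_iff.1 hpos
    exact G.mem_of_prob_wait_pos hσ
  have key : G.atlSem .one m (waitSet B C) := by
    refine G.atlSem_wait_of_mem (Z := {t | t ∈ X ∧ p t = p m}) (fun t ht => hXB t ht.2) ?_
      ⟨hmX, rfl⟩
    rintro t ⟨htX, ht⟩
    by_cases htC : t ∈ C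
    · exact Or.inl htC
    refine Or.inr ?_
    have hdest : ∀ a ∈ G.mov t, G.dest t a ⊆ X := fun a ha t' ht' h =>
      htX (G.atlSem_until_of_cpre hG (hXB t ht) ⟨a, ha, t', ht', h⟩)
    let V (a : A) : ℝ≥0∞ := ∑' t', G.trans t a t' * p t'
    obtain ⟨a, ha, hmax⟩ := Set.exists_max_image (G.mov t) V (Set.toFinite _) (G.mov_nonempty t)
    -- A randomized first choice averages the values `V b`, so the best pure action does at least as
    -- well.
    have hV : p m ≤ V a := by
      rw [← ht]
      refine iSup_le fun σ => (G.prob_wait_le σ htC).trans ?_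
      calc ∑' t', G.nextState σ G.natural [] t t' *
            G.prob t' (σ.shift t) G.natural (waitSet B C)
          ≤ ∑' t', G.nextState σ G.natural [] t t' * p t' :=
            ENNReal.tsum_le_tsum fun t' => mul_le_mul_right (hle t' _) _
        _ = ∑' t', ∑' b, σ.choose [] t b * (G.trans t b t' * p t') := by
            refine tsum_congr fun t' => ?_
            rw [nextState, PMF.bind_apply, ← ENNReal.tsum_mul_right]
            simp_rw [mul_assoc]
            rfl
        _ = ∑' b, σ.choose [] t b * V b := by
            rw [ENNReal.tsum_comm]
            simp_rw [ENNReal.tsum_mul_left, V]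
        _ ≤ ∑' b, σ.choose [] t b * V a := by
            refine ENNReal.tsum_le_tsum fun b => ?_
            by_cases hb : b ∈ (σ.choose [] t).support
            · exact mul_le_mul_right (hmax b (σ.support_subset _ _ hb)) _
            · rw [((σ.choose [] t).apply_eq_zero_iff b).2 hb, zero_mul, zero_mul]
        _ = V a := by rw [ENNReal.tsum_mul_right, PMF.tsum_coe, one_mul]
    exact ⟨a, ha, fun t' ht' => ⟨hdest a ha ht', (G.trans t a).eq_of_le_tsum_mul htop
      (fun t'' ht'' => hm t'' (hdest a ha ht'')) hV t' ht'⟩⟩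
  exact hmX (G.atlSem_until_of_mem key)

/-- A feasible play that violates the goal can only meet `ht` by reaching `R` through `B`, and from
`R` success has positive probability. -/
theorem forallPos_wait_of_none {B C R : Set S}
    (hR : ∀ t ∈ R, G.posSem .forallPos t (waitSet B C)) {t : S}
    (ht : G.atlSem .none t (waitSet B (R ∪ C))) : G.posSem .forallPos t (waitSet B C) := by
  intro σ
  by_cases h : G.outcome t σ G.natural ⊆ waitSet B C
  · rw [G.prob_eq_one h]
    exact one_pos
  · obtain ⟨ω, hω, hE⟩ := Set.not_subset.1 h
    rcases ht σ G.natural hω with h | ⟨j, hj, h⟩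
    · exact absurd (Or.inl h) hE
    · exact G.prob_pos_of_path (measurableSet_waitSet B C)
        (fun s hs ω => consPlay_mem_waitSet hs) j hω (fun i hi => h i hi.le)
        (hR _ (hj.resolve_right fun hC => hE (Or.inr ⟨j, hC, h⟩)))

theorem forallPos_wait_of_until {B C R : Set S}
    (hR : ∀ t ∈ R, G.posSem .forallPos t (waitSet B C)) {t : S}
    (ht : G.atlSem .p t (untilSet B {t | G.atlSem .none t (waitSet B (R ∪ C))})) :
    G.posSem .forallPos t (waitSet B C) :=
  G.posSem_of_atlSem (q := .forallPos) ht fun _ _ hω ⟨j, hj, h⟩ =>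
    G.prob_pos_of_path (measurableSet_waitSet B C) (fun _ hs _ => consPlay_mem_waitSet hs) j hω h
      (G.forallPos_wait_of_none hR hj)

/-- In a finite alternating MDP, the states where a safety goal has positive probability against
every strategy form the least set that is closed under the passage from `R` to the states from
which player p can force a visit of a state where every play is safe up to a visit of `R`. -/
theorem mem_of_forallPos_wait [Finite S] {B C R : Set S}
    (halt : ∀ s, (∀ a ∈ G.mov s, (G.dest s a).Subsingleton) ∨ (G.mov s).Subsingleton)
    (hR : ∀ t ∈ R, G.posSem .forallPos t (waitSet B C))
    (hmax : ∀ t, G.atlSem .p t (untilSet B {t | G.atlSem .none t (waitSet B (R ∪ C))}) → t ∈ R)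
    {s : S} (hs : G.posSem .forallPos s (waitSet B C)) : s ∈ R := by
  classical
  by_contra hsR
  have hG := G.isFinitelyBranching_of_finite
  have _ := G.finite_actions
  let _ := Fintype.ofFinite A
  have hRB : R ⊆ B := fun t ht =>
    have ⟨a, ha⟩ := Classical.axiomOfChoice (r := fun s a => a ∈ G.mov s) G.mov_nonempty
    G.mem_of_prob_wait_pos (hR t ht (G.pureStrategy₁ a ha))
  have hRN : R ⊆ {t | G.atlSem .none t (waitSet B (R ∪ C))} := fun t ht =>
    show G.atlSem .none t _ from
      G.atlSem_wait_of_mem (C := R ∪ C) hRB (fun t ht => Or.inl (Or.inl ht)) ht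
  -- Player 1 randomizes uniformly over the actions that surely avoid `R`, if any. Since all of them
  -- get positive probability, the maximum principle speaks about every one.
  let D (t : S) : Set A := {a | a ∈ G.mov t ∧ ∀ t' ∈ G.dest t a, t' ∉ R}
  let D' (t : S) : Set A := if (D t).Nonempty then D t else G.mov t
  have hD' : ∀ t, (D' t).Nonempty := fun t => by
    simp only [D']
    split_ifs with h
    exacts [h, G.mov_nonempty t]
  have hD'mov : ∀ t, D' t ⊆ G.mov t := fun t => by
    simp only [D']
    split_ifs with h
    exacts [fun a ha => ha.1, subset_rfl]
  let σ : G.Strategy₁ :=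
    { choose := fun _ t => PMF.uniformOfFinset (D' t).toFinset (by simpa using hD' t)
      support_subset := fun _ t => by
        rw [PMF.support_uniformOfFinset, Set.coe_toFinset]; exact hD'mov t }
  have hσ : ∀ t a, a ∈ (D' t) → 0 < σ.choose [] t a := fun t a ha => pos_iff_ne_zero.2 <|
    (PMF.mem_support_iff _ _).1 (by rw [PMF.support_uniformOfFinset]; simpa using ha)
  let p (t : S) : ℝ≥0∞ := G.prob t σ G.natural (waitSet B C)
  obtain ⟨m, hmX, hm⟩ := Set.exists_max_image Rᶜ p (Set.toFinite _) ⟨s, hsR⟩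
  have hpos : 0 < p m := (hs σ).trans_le (hm s hsR)
  have htop : p m ≠ ∞ := ne_top_of_le_ne_top ENNReal.one_ne_top (G.prob_le_one m σ _ _)
  have hWB : ∀ t, p t = p m → t ∈ B := fun t ht =>
    G.mem_of_prob_wait_pos (σ := σ) (hpos.trans_eq ht.symm)
  have key : G.atlSem .none m (waitSet B (R ∪ C)) := by
    refine G.atlSem_wait_of_mem (Z := {t | t ∈ R ∨ (t ∉ R ∧ p t = p m)}) ?_ ?_
      (Or.inr ⟨hmX, rfl⟩)
    · exact fun t ht => ht.elim (@hRB t) fun h => hWB t h.2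
    rintro t (ht | ⟨htR, ht⟩)
    · exact Or.inl (Or.inl ht)
    by_cases htC : t ∈ C
    · exact Or.inl (Or.inr htC)
    refine Or.inr fun a ha t' ht' => ?_
    by_cases ht'R : t' ∈ R
    · exact Or.inl ht'R
    -- If no action avoided `R`, player p could enter `R` at once, and closure would put `t` in `R`.
    have hD : (D t).Nonempty := by
      by_contra hD
      refine htR (hmax t (G.atlSem_until_of_cpre hG (hWB t ht) fun a ha => ?_))
      by_contra h
      exact hD ⟨a, ha, fun t' ht' h' => h ⟨t', ht', show G.atlSem .p t' (untilSet B _) from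
        G.atlSem_until_of_mem (hRN h')⟩⟩
    have hDt : D' t = D t := if_pos hD
    have hsupp : ∀ x ∈ (G.nextState σ G.natural [] t).support, x ∉ R := fun x hx => by
      obtain ⟨b, -, hb, hbx⟩ := G.mem_support_nextState.1 hx
      have hbD : b ∈ D' t := by
        have := (PMF.mem_support_iff _ _).2 hb.ne'
        rw [PMF.support_uniformOfFinset] at this
        simpa using this
      rw [hDt] at hbD
      exact hbD.2 x hbx.ne'
    -- Alternation enters here: an action with one destination outside `R` avoids `R` entirely,
    -- being either deterministic or the only action.
    have haD : a ∈ D t := by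
      rcases halt t with h | h
      · exact ⟨ha, fun x hx => h a ha hx ht' ▸ ht'R⟩
      · obtain ⟨b, hb⟩ := hD
        exact h ha hb.1 ▸ hb
    have hle : p m ≤ ∑' x, G.nextState σ G.natural [] t x * p x :=
      ht ▸ G.prob_wait_le σ htC
    refine Or.inr ⟨ht'R, (G.nextState σ G.natural [] t).eq_of_le_tsum_mul htop
      (fun x hx => hm x (hsupp x hx)) hle t' ?_⟩
    exact G.mem_support_nextState.2 ⟨a, ha, hσ t a (hDt ▸ haD), pos_iff_ne_zero.2 ht'⟩
  exact hmX (hmax m (G.atlSem_until_of_mem key))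

/-! ### Translation of `QRCTL^{>0}` into ATL on finite AMDPs -/

/-- The sets of states that are definable in ATL. -/
def atlDefinable : Set (Set S) := {Z | ∃ ψ, Z = {s | G.Sat G.atlSem ψ s}}

theorem atlDefinable_until {B C : Set S} (q : ATLQuantifier) (hB : B ∈ G.atlDefinable)
    (hC : C ∈ G.atlDefinable) : {s | G.atlSem q s (untilSet B C)} ∈ G.atlDefinable := by
  obtain ⟨ψ₁, rfl⟩ := hB
  obtain ⟨ψ₂, rfl⟩ := hC
  exact ⟨.until q ψ₁ ψ₂, rfl⟩

theorem atlDefinable_wait {B C : Set S} (q : ATLQuantifier) (hB : B ∈ G.atlDefinable)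
    (hC : C ∈ G.atlDefinable) : {s | G.atlSem q s (waitSet B C)} ∈ G.atlDefinable := by
  obtain ⟨ψ₁, rfl⟩ := hB
  obtain ⟨ψ₂, rfl⟩ := hC
  exact ⟨.wait q ψ₁ ψ₂, rfl⟩

theorem atlDefinable_union {B C : Set S} (hB : B ∈ G.atlDefinable) (hC : C ∈ G.atlDefinable) :
    B ∪ C ∈ G.atlDefinable := by
  obtain ⟨ψ₁, rfl⟩ := hB
  obtain ⟨ψ₂, rfl⟩ := hC
  exact ⟨.or ψ₁ ψ₂, rfl⟩

/-- Instead of iterating the fixpoint operator, take a maximal definable subset of the truth set: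
maximality gives closure, and closure gives equality. -/
theorem atlDefinable_forallPos_wait [Finite S] {B C : Set S}
    (halt : ∀ s, (∀ a ∈ G.mov s, (G.dest s a).Subsingleton) ∨ (G.mov s).Subsingleton)
    (hB : B ∈ G.atlDefinable) (hC : C ∈ G.atlDefinable) :
    {s | G.posSem .forallPos s (waitSet B C)} ∈ G.atlDefinable := by
  let V : Set S := {s | G.posSem .forallPos s (waitSet B C)}
  have hne : ∅ ∈ {R | R ∈ G.atlDefinable ∧ R ⊆ V} :=
    ⟨⟨.neg .tru, by ext; simp [Sat]⟩, Set.empty_subset _⟩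
  obtain ⟨R, hR⟩ := (Set.toFinite {R | R ∈ G.atlDefinable ∧ R ⊆ V}).exists_maximal ⟨∅, hne⟩
  obtain ⟨hRd, hRV⟩ := hR.prop
  let R' : Set S := {t | G.atlSem .p t (untilSet B {t | G.atlSem .none t (waitSet B (R ∪ C))})}
  have hR' : R' ∪ R ⊆ R := hR.2 ⟨G.atlDefinable_union (G.atlDefinable_until .p hB
    (G.atlDefinable_wait .none hB (G.atlDefinable_union hRd hC))) hRd,
    Set.union_subset (fun t => G.forallPos_wait_of_until hRV) hRV⟩ Set.subset_union_right
  have hVR : V = R := Set.Subset.antisymm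
    (fun s hs => G.mem_of_forallPos_wait halt hRV (fun t ht => hR' (Or.inl ht)) hs) hRV
  exact (congrArg (· ∈ G.atlDefinable) hVR).mpr hRd

theorem atlDefinable_sat_posSem [Finite S]
    (halt : ∀ s, (∀ a ∈ G.mov s, (G.dest s a).Subsingleton) ∨ (G.mov s).Subsingleton)
    (ψ : StateFormula AP PosQuantifier) : {s | G.Sat G.posSem ψ s} ∈ G.atlDefinable := by
  have hG := G.isFinitelyBranching_of_finite
  induction ψ with
  | tru => exact ⟨.tru, rfl⟩
  | atom q => exact ⟨.atom q, rfl⟩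
  | neg ψ ih =>
    obtain ⟨χ, h⟩ := ih
    exact ⟨.neg χ, congrArg compl h⟩
  | or ψ₁ ψ₂ ih₁ ih₂ => exact G.atlDefinable_union ih₁ ih₂
  | quant q ψ ih =>
    convert ih using 1
    ext s
    exact G.posSem_eval_zero q {s | G.Sat G.posSem ψ s} s
  | next q ψ ih =>
    obtain ⟨χ, h⟩ := ih
    refine ⟨.next q.toATL χ, ?_⟩
    ext s
    refine (G.posSem_next q {s | G.Sat G.posSem ψ s} s).trans ?_
    rw [h]
    rfl
  | wait q ψ₁ ψ₂ ih₁ ih₂ =>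
    cases q with
    | existsPos =>
      convert G.atlDefinable_until .oneP ih₁ (G.atlDefinable_wait .one ih₁ ih₂) using 1
      ext s
      exact G.posSem_existsPos_wait _ _ s
    | forallPos => exact G.atlDefinable_forallPos_wait halt ih₁ ih₂
  | _ q ψ₁ ψ₂ ih₁ ih₂ =>
    convert G.atlDefinable_until q.toATL ih₁ ih₂ using 1
    ext s
    exact G.posSem_until hG q _ _ s

theorem atlEquiv_subset_posEquiv [Finite S] {turn : AP} (h : G.IsAlternating turn) :
    G.atlEquiv ⊆ G.posEquiv := by
  have _ := G.finite_actions
  obtain ⟨S₁, Sₚ, -, hu, h₁, hₚ⟩ := h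
  have halt : ∀ s, (∀ a ∈ G.mov s, (G.dest s a).Subsingleton) ∨ (G.mov s).Subsingleton := by
    intro s
    rcases hu.symm ▸ Set.mem_univ s with hs | hs
    · exact Or.inl fun a ha => (Set.ncard_le_one_iff_subsingleton).1 ((h₁ s hs).2 a ha).le
    · exact Or.inr ((Set.ncard_le_one_iff_subsingleton).1 (hₚ s hs).2.le)
  rintro ⟨s, t⟩ hst ψ
  obtain ⟨χ, hχ⟩ := G.atlDefinable_sat_posSem halt ψ
  have hiff : ∀ s, G.Sat G.posSem ψ s ↔ G.Sat G.atlSem χ s := fun s => Set.ext_iff.1 hχ s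
  exact (hiff s).trans ((hst χ).trans (hiff t).symm)

end MDP

namespace MDP

variable {AP S A : Type*}

/-! ### Bisimulations for the 2-player game -/

/-- A symmetric relation on the states that ATL formulas cannot distinguish: related states have
the same labels, player 1 can match the choices of player 1, and both players together can match
every transition. -/
structure IsATLBisimulation (G : MDP AP S A) (r : S → S → Prop) : Prop where
  symm : ∀ {s t}, r s t → r t s
  label : ∀ {s t}, r s t → G.label s = G.label t
  force : ∀ {s t}, r s t → ∀ a ∈ G.mov s, ∃ b ∈ G.mov t, ∀ y ∈ G.dest t b, ∃ x ∈ G.dest s a, r x y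
  step : ∀ {s t}, r s t → ∀ a ∈ G.mov s, ∀ x ∈ G.dest s a, ∃ b ∈ G.mov t, ∃ y ∈ G.dest t b, r x y

namespace IsATLBisimulation

variable {G : MDP AP S A} {r : S → S → Prop}

/-- The sets that do not separate related states. -/
def IsInvariant (r : S → S → Prop) (Z : Set S) : Prop := ∀ s t, r s t → s ∈ Z → t ∈ Z

theorem isInvariant_compl (hr : G.IsATLBisimulation r) {Z : Set S} (hZ : IsInvariant r Z) :
    IsInvariant r Zᶜ := fun s t hst hs ht => hs (hZ t s (hr.symm hst) ht)

/-- `force` handles player 1 and `step` the joint coalition; the other two follow by one-round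
duality, as `r` is symmetric. -/
theorem isInvariant_cpre (hr : G.IsATLBisimulation r) (q : ATLQuantifier) {Z : Set S}
    (hZ : IsInvariant r Z) : IsInvariant r (G.cpre q Z) := by
  have one : ∀ Z, IsInvariant r Z → IsInvariant r (G.cpre .one Z) := by
    rintro Z hZ s t hst ⟨a, ha, h⟩
    obtain ⟨b, hb, h'⟩ := hr.force hst a ha
    exact ⟨b, hb, fun y hy => let ⟨x, hx, hxy⟩ := h' y hy; hZ x y hxy (h x hx)⟩
  have oneP : ∀ Z, IsInvariant r Z → IsInvariant r (G.cpre .oneP Z) := by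
    rintro Z hZ s t hst ⟨a, ha, x, hx, h⟩
    obtain ⟨b, hb, y, hy, hxy⟩ := hr.step hst a ha x hx
    exact ⟨b, hb, y, hy, hZ x y hxy h⟩
  cases q with
  | one => exact one Z hZ
  | p =>
    have := hr.isInvariant_compl (one _ (hr.isInvariant_compl hZ))
    rwa [compl_cpre, compl_compl] at this
  | oneP => exact oneP Z hZ
  | none =>
    have := hr.isInvariant_compl (oneP _ (hr.isInvariant_compl hZ))
    rwa [compl_cpre, compl_compl] at this

theorem isInvariant_until (hr : G.IsATLBisimulation r) (hG : G.IsFinitelyBranching)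
    (q : ATLQuantifier) {B C : Set S} (hB : IsInvariant r B) (hC : IsInvariant r C) :
    IsInvariant r {s | G.atlSem q s (untilSet B C)} := by
  have key : ∀ n, IsInvariant r (G.reach q B C n) := by
    intro n
    induction n with
    | zero => exact hC
    | succ n ih =>
      rintro s t hst (h | ⟨h, h'⟩)
      exacts [Or.inl (hC s t hst h), Or.inr ⟨hB s t hst h, hr.isInvariant_cpre q ih s t hst h'⟩]
  intro s t hst hs
  obtain ⟨n, hn⟩ := (G.atlSem_until_iff hG).1 hs
  exact (G.atlSem_until_iff hG).2 ⟨n, key n s t hst hn⟩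

theorem isInvariant_sat (hr : G.IsATLBisimulation r) (hG : G.IsFinitelyBranching)
    (ψ : StateFormula AP ATLQuantifier) : IsInvariant r {s | G.Sat G.atlSem ψ s} := by
  induction ψ with
  | tru => exact fun _ _ _ _ => trivial
  | atom q =>
    intro s t hst hs
    change q ∈ G.label t
    rw [← hr.label hst]
    exact hs
  | neg ψ ih => exact hr.isInvariant_compl ih
  | or ψ₁ ψ₂ ih₁ ih₂ => exact fun s t hst => Or.imp (ih₁ s t hst) (ih₂ s t hst)
  | quant q ψ ih =>
    intro s t hst hs
    exact (G.atlSem_eval_zero q _ t).2 (ih s t hst ((G.atlSem_eval_zero q _ s).1 hs))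
  | next q ψ ih =>
    intro s t hst hs
    exact (G.atlSem_next q _ t).2 (hr.isInvariant_cpre q ih s t hst ((G.atlSem_next q _ s).1 hs))
  | wait q ψ₁ ψ₂ ih₁ ih₂ =>
    intro s t hst hs
    refine (G.atlSem_wait_iff hG).2 fun ht => (G.atlSem_wait_iff hG).1 hs ?_
    exact hr.isInvariant_until hG q.dual (hr.isInvariant_compl ih₂) (hr.isInvariant_compl ih₁)
      t s (hr.symm hst) ht
  | _ q ψ₁ ψ₂ ih₁ ih₂ => exact hr.isInvariant_until hG q ih₁ ih₂

theorem mem_atlEquiv (hr : G.IsATLBisimulation r) (hG : G.IsFinitelyBranching) {s t : S}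
    (hst : r s t) : (s, t) ∈ G.atlEquiv := fun ψ =>
  ⟨hr.isInvariant_sat hG ψ s t hst, hr.isInvariant_sat hG ψ t s (hr.symm hst)⟩

end IsATLBisimulation

/-- The formula that the quantifier `q` requires `turn` to be false forever. -/
def neverTurn (turn : AP) (q : PosQuantifier) : StateFormula AP PosQuantifier :=
  -- With an unsatisfiable right argument, W means "always".
  .wait q (.neg (.atom turn)) (.neg .tru)

theorem sat_neverTurn (G : MDP AP S A) (turn : AP) (q : PosQuantifier) (s : S) :
    G.Sat G.posSem (neverTurn turn q) s ↔
      G.posSem q s (waitSet {t | turn ∉ G.label t} ∅) := by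
  have : (∅ : Set S) = {t | G.Sat G.posSem (.neg .tru) t} := by
    ext; simp [Sat]
  rw [this]
  rfl

/-! ### A finite MDP that is not alternating -/

/-- The successors in `gadget`. -/
def gadgetDest : Fin 4 → Fin 3 → Finset (Fin 4)
  | 0, 0 => {0}
  | 0, 1 => {0, 2}
  | 0, 2 => {0, 2, 3}
  | 1, 0 => {1}
  | 1, 1 => {1}
  | 1, 2 => {1, 2, 3}
  | 2, _ => {2}
  | 3, _ => {3}

theorem gadgetDest_nonempty : ∀ s a, (gadgetDest s a).Nonempty := by decide

/-- Two initial states `0` and `1`, where player 1 can wait or move to the absorbing states `2`,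
labelled with `turn`, and `3`. Only at `0` there is an action that may lead to `2` but not
to `3`. -/
def gadget (turn : AP) : MDP AP (Fin 4) (Fin 3) where
  countable_states := inferInstance
  finite_actions := inferInstance
  mov _ := Set.univ
  mov_nonempty _ := Set.univ_nonempty
  trans s a := PMF.uniformOfFinset (gadgetDest s a) (gadgetDest_nonempty s a)
  label s := {q | s = 2 ∧ q = turn}

variable (turn : AP)

theorem mem_dest_gadget {s t : Fin 4} {a : Fin 3} :
    t ∈ (gadget turn).dest s a ↔ t ∈ gadgetDest s a := by
  simp [dest, gadget]

theorem turn_mem_label_gadget {s : Fin 4} : turn ∈ (gadget turn).label s ↔ s = 2 := by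
  simp [gadget]

theorem gadget_not_isAlternating : ¬ (gadget turn).IsAlternating turn := by
  rintro ⟨S₁, Sₚ, -, hu, h₁, hₚ⟩
  rcases hu.symm ▸ Set.mem_univ (0 : Fin 4) with h | h
  · simpa using (turn_mem_label_gadget turn).1 (h₁ 0 h).1
  · simpa [gadget, Set.ncard_univ] using (hₚ 0 h).2

/-- For `force`, waiting at `0` or `1` answers every action at the other. For `step`, the action `2`
offers every transition that is needed. -/
theorem gadget_isATLBisimulation :
    (gadget turn).IsATLBisimulation fun s t => s = t ∨ (s < 2 ∧ t < 2) where
  symm := fun h => h.imp Eq.symm And.symm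
  label := by
    rintro s t (rfl | ⟨hs, ht⟩)
    · rfl
    · simp [gadget, hs.ne, ht.ne]
  force := by
    simp only [mem_dest_gadget]
    simp only [gadget, Set.mem_univ, true_and, forall_const]
    decide
  step := by
    simp only [mem_dest_gadget]
    simp only [gadget, Set.mem_univ, true_and, forall_const]
    decide

/-- Player 1 always plays `1`. The value at `0` is then at most an average over `0` and `2`, so it
equals the value at `2`, which is zero. -/
theorem gadget_not_sat_zero : ¬ (gadget turn).Sat (gadget turn).posSem
    (neverTurn turn .forallPos) 0 := by
  rw [sat_neverTurn]
  intro h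
  let σ : (gadget turn).Strategy₁ := (gadget turn).pureStrategy₁ (fun _ => 1) fun _ => trivial
  have h0 := h σ
  let p (t : Fin 4) : ℝ≥0∞ := (gadget turn).prob t σ (gadget turn).natural
    (waitSet {t | turn ∉ (gadget turn).label t} ∅)
  have hp2 : p 2 = 0 := by
    by_contra h2
    exact (gadget turn).mem_of_prob_wait_pos (pos_iff_ne_zero.2 h2)
      ((turn_mem_label_gadget turn).2 rfl)
  have hsupp : ∀ t, t ∈ ((gadget turn).nextState σ (gadget turn).natural [] 0).support ↔
      t = 0 ∨ t = 2 := by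
    intro t
    have : (gadget turn).nextState σ (gadget turn).natural [] 0 = (gadget turn).trans 0 1 :=
      PMF.pure_bind _ _
    rw [this]
    exact (mem_dest_gadget turn).trans (by simp [gadgetDest])
  have := ((gadget turn).nextState σ (gadget turn).natural [] 0).eq_of_le_tsum_mul
    (p := p) (M := p 0) (ne_top_of_le_ne_top ENNReal.one_ne_top ((gadget turn).prob_le_one _ _ _ _))
    (fun t ht => by
      rcases (hsupp t).1 ht with rfl | rfl
      · exact le_rfl
      · rw [hp2]; exact zero_le)
    ((gadget turn).prob_wait_le σ (Set.notMem_empty 0)) 2 ((hsupp 2).2 (Or.inr rfl))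
  exact h0.ne' (this.symm.trans hp2)

theorem gadget_sat_one : (gadget turn).Sat (gadget turn).posSem (neverTurn turn .forallPos) 1 := by
  rw [sat_neverTurn]
  set B : Set (Fin 4) := {t | turn ∉ (gadget turn).label t} with hB
  have hE := measurableSet_waitSet B ∅
  have h1B : (1 : Fin 4) ∈ B := fun h => by simpa using (turn_mem_label_gadget turn).1 h
  have h3 : ∀ σ, 0 < (gadget turn).prob 3 σ (gadget turn).natural (waitSet B ∅) := by
    intro σ
    have : (gadget turn).atlSem .none 3 (waitSet B ∅) := by
      refine (gadget turn).atlSem_wait_of_mem (Z := {3}) ?_ ?_ rfl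
      · rintro _ rfl h
        simpa using (turn_mem_label_gadget turn).1 h
      · rintro _ rfl
        refine Or.inr fun a _ t ht => ?_
        simpa [gadgetDest] using (mem_dest_gadget turn).1 ht
    rw [(gadget turn).prob_eq_one (this σ _)]
    exact one_pos
  -- Induction on the time of first departure from `1`: every action that can leave `1` can also
  -- lead to the safe state `3`.
  have key : ∀ k, ∀ σ, ∀ ω ∈ (gadget turn).outcome 1 σ (gadget turn).natural,
      (∀ i ≤ k, ω i = 1) → ω (k + 1) ≠ 1 →
      0 < (gadget turn).prob 1 σ (gadget turn).natural (waitSet B ∅) := by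
    intro k
    induction k with
    | zero =>
      intro σ ω hω _ hk
      have h0 := ((gadget turn).mem_outcome.1 hω).2 0
      rw [hω.1, List.ofFn_zero, mem_support_nextState] at h0
      obtain ⟨a, ha, hσ, hτ⟩ := h0
      have hmem : ω (0 + 1) ∈ gadgetDest 1 a := (mem_dest_gadget turn).1 hτ.ne'
      have ha3 : 3 ∈ gadgetDest 1 a := by
        generalize ω (0 + 1) = x at hmem hk
        clear hσ hτ ha
        revert a x
        decide
      refine (gadget turn).prob_pos_of_succ hE (t := 3) ?_
        (fun ω => consPlay_mem_waitSet h1B) (h3 _)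
      exact (gadget turn).mem_support_nextState.2
        ⟨a, ha, hσ, pos_iff_ne_zero.2 ((mem_dest_gadget turn).2 ha3)⟩
    | succ k ih =>
      intro σ ω hω hi hk
      have h0 := ((gadget turn).mem_outcome.1 hω).2 0
      rw [hω.1, List.ofFn_zero, hi (0 + 1) (by omega)] at h0
      have hω' := (gadget turn).outcome_natural_shift hω
      rw [hi 1 (by omega)] at hω'
      exact (gadget turn).prob_pos_of_succ hE h0 (fun ω => consPlay_mem_waitSet h1B)
        (ih _ _ hω' (fun i hik => hi (i + 1) (by omega)) hk)
  intro σ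
  by_cases h : ∃ ω ∈ (gadget turn).outcome 1 σ (gadget turn).natural, ∃ k, ω k ≠ 1
  · obtain ⟨ω, hω, hex⟩ := h
    obtain ⟨k, hk⟩ : ∃ k, Nat.find hex = k + 1 := Nat.exists_eq_succ_of_ne_zero fun h =>
      (h ▸ Nat.find_spec hex) hω.1
    refine key k σ ω hω (fun i hi => ?_) (hk ▸ Nat.find_spec hex)
    exact not_not.1 (Nat.find_min hex (by omega))
  · push Not at h
    rw [(gadget turn).prob_eq_one fun ω hω => show ω ∈ waitSet B ∅ from
      Or.inl fun j => h ω hω j ▸ h1B]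
    exact one_pos

theorem gadget_not_subset : ¬ (gadget turn).atlEquiv ⊆ (gadget turn).posEquiv := fun h =>
  gadget_not_sat_zero turn ((h ((gadget_isATLBisimulation turn).mem_atlEquiv
    (gadget turn).isFinitelyBranching_of_finite (s := 0) (t := 1) (Or.inr (by decide)))
    _).2 (gadget_sat_one turn))

end MDP

/-- The distribution that gives `x` the probability `p` and `y` the remaining probability. -/
def PMF.twoPoint {α : Type*} (p : ℝ≥0) (hp : p ≤ 1) (x y : α) : PMF α :=
  (PMF.ofFintype (fun b : Bool => cond b (p : ℝ≥0∞) (1 - p)) (by simp [hp])).map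
    fun b => cond b x y

theorem PMF.mem_support_twoPoint {α : Type*} {p : ℝ≥0} (hp : p < 1) (hp0 : 0 < p) {x y z : α} :
    z ∈ (PMF.twoPoint p hp.le x y).support ↔ z = x ∨ z = y := by
  rw [twoPoint, PMF.mem_support_map_iff]
  have h : 1 - (p : ℝ≥0∞) ≠ 0 := (tsub_pos_of_lt (by exact_mod_cast hp)).ne'
  simp [hp0.ne', h.symm, eq_comm, or_comm]

theorem PMF.twoPoint_apply_left {α : Type*} {p : ℝ≥0} (hp : p ≤ 1) {x y : α} (hxy : x ≠ y) :
    PMF.twoPoint p hp x y x = p := by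
  classical
  rw [twoPoint, PMF.map_apply, tsum_bool]
  simp [hxy]

namespace MDP

/-! ### An infinite alternating MDP -/

/-- The probability to survive forever in the state `(true, n + 1)` of `chain`. -/
def survival (n : ℕ) : ℝ≥0 := (n + 1) / (n + 2)

/-- The probability to survive the next step in the state `(b, n + 1)` of `chain`. -/
def stepSurvival : Bool → ℕ → ℝ≥0
  -- Quotients chosen so that the product over later steps telescopes.
  | true, n => survival n / survival (n + 1)
  | false, _ => 1 / 2

theorem survival_pos (n : ℕ) : 0 < survival n := by
  unfold survival; positivity

theorem survival_le_one (n : ℕ) : survival n ≤ 1 := by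
  unfold survival
  exact div_le_one_of_le₀ (by gcongr; norm_num) (by positivity)

theorem survival_lt (n : ℕ) : survival n < survival (n + 1) := by
  unfold survival
  rw [div_lt_div_iff₀ (by positivity) (by positivity), ← NNReal.coe_lt_coe]
  push_cast
  nlinarith

theorem stepSurvival_pos (b : Bool) (n : ℕ) : 0 < stepSurvival b n := by
  cases b
  · simp [stepSurvival]
  · exact div_pos (survival_pos n) (survival_pos _)

theorem stepSurvival_lt_one (b : Bool) (n : ℕ) : stepSurvival b n < 1 := by
  cases b
  · exact NNReal.half_lt_self one_ne_zero
  · exact (div_lt_one (survival_pos _)).2 (survival_lt n)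

variable {AP : Type*} (turn : AP)

/-- Two Markov chains where in each step play survives or is absorbed in a state labelled with
`turn`. -/
def chain : MDP AP (Bool × ℕ) Unit where
  countable_states := inferInstance
  finite_actions := inferInstance
  mov _ := Set.univ
  mov_nonempty _ := Set.univ_nonempty
  trans s _ := match s with
    | (b, 0) => PMF.pure (b, 0)
    | (b, n + 1) => PMF.twoPoint (stepSurvival b n) (stepSurvival_lt_one b n).le (b, n + 2) (b, 0)
  label s := {q | s.2 = 0 ∧ q = turn}

theorem dest_chain_zero (b : Bool) (a : Unit) : (chain turn).dest (b, 0) a = {(b, 0)} :=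
  PMF.support_pure _

theorem dest_chain_succ (b : Bool) (n : ℕ) (a : Unit) :
    (chain turn).dest (b, n + 1) a = {(b, n + 2), (b, 0)} :=
  Set.ext fun _ => PMF.mem_support_twoPoint (stepSurvival_lt_one b n) (stepSurvival_pos b n)

theorem turn_mem_label_chain {s : Bool × ℕ} : turn ∈ (chain turn).label s ↔ s.2 = 0 := by
  simp [chain]

theorem chain_isFinitelyBranching : (chain turn).IsFinitelyBranching := by
  rintro ⟨b, _ | n⟩ a -
  · rw [dest_chain_zero]; exact Set.toFinite _
  · rw [dest_chain_succ]; exact Set.toFinite _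

theorem chain_isAlternating : (chain turn).IsAlternating turn := by
  refine ⟨{s | s.2 = 0}, {s | s.2 = 0}ᶜ, disjoint_compl_right, Set.union_compl_self _, ?_, ?_⟩
  · rintro ⟨b, n⟩ (rfl : n = 0)
    refine ⟨(turn_mem_label_chain turn).2 rfl, fun a _ => ?_⟩
    rw [dest_chain_zero, Set.ncard_singleton]
  · exact fun s hs => ⟨mt (turn_mem_label_chain turn).1 hs, by simp [chain, Set.ncard_univ]⟩

/-- The chains have the same graph and labels and differ only in their probabilities. -/
theorem chain_isATLBisimulation : (chain turn).IsATLBisimulation fun s t => s.2 = t.2 where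
  symm := Eq.symm
  label := fun h => by simp [chain, h]
  force := by
    rintro ⟨b, _ | n⟩ ⟨c, m⟩ (rfl : _ = m) a - <;> refine ⟨a, trivial, ?_⟩
    · simp [dest_chain_zero]
    · simp [dest_chain_succ]
  step := by
    rintro ⟨b, _ | n⟩ ⟨c, m⟩ (rfl : _ = m) a - x hx <;> refine ⟨a, trivial, ?_⟩
    · rw [dest_chain_zero] at hx ⊢
      obtain rfl := hx
      exact ⟨_, rfl, rfl⟩
    · rw [dest_chain_succ] at hx ⊢
      rcases hx with rfl | rfl
      exacts [⟨_, Or.inl rfl, rfl⟩, ⟨_, Or.inr rfl, rfl⟩]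

theorem nextState_chain (σ : (chain turn).Strategy₁) (h : List (Bool × ℕ)) (s : Bool × ℕ) :
    (chain turn).nextState σ (chain turn).natural h s = (chain turn).trans s () := by
  ext t
  rw [nextState, PMF.bind_apply, tsum_fintype]
  have h1 : σ.choose h s () = 1 := by simpa using (σ.choose h s).tsum_coe
  simp [natural, h1]

theorem trans_chain_succ (b : Bool) (n : ℕ) :
    (chain turn).trans (b, n + 1) () (b, n + 2) = stepSurvival b n :=
  PMF.twoPoint_apply_left (stepSurvival_lt_one b n).le (by simp)

theorem chain_not_sat : ¬ (chain turn).Sat (chain turn).posSem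
    (neverTurn turn .existsPos) (false, 1) := by
  rw [sat_neverTurn]
  set B : Set (Bool × ℕ) := {t | turn ∉ (chain turn).label t} with hB
  let p (n : ℕ) : ℝ≥0∞ := ⨆ σ : (chain turn).Strategy₁,
    (chain turn).prob (false, n) σ (chain turn).natural (waitSet B ∅)
  have hle : ∀ n σ, (chain turn).prob (false, n) σ (chain turn).natural (waitSet B ∅) ≤ p n :=
    fun n σ => le_iSup (fun σ : (chain turn).Strategy₁ =>
      (chain turn).prob (false, n) σ (chain turn).natural (waitSet B ∅)) σ
  have hp : ∀ n, p (n + 1) ≤ 2⁻¹ * p (n + 2) := by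
    refine fun n => iSup_le fun σ => ((chain turn).prob_wait_le σ (Set.notMem_empty _)).trans ?_
    rw [nextState_chain, tsum_eq_single (false, n + 2), trans_chain_succ]
    · refine mul_le_mul' ?_ (hle _ _)
      simp [stepSurvival]
    · intro t ht
      by_cases hd : t ∈ (chain turn).dest (false, n + 1) ()
      · rw [dest_chain_succ] at hd
        obtain rfl := hd.resolve_left ht
        convert mul_zero _
        by_contra h
        exact (chain turn).mem_of_prob_wait_pos (pos_iff_ne_zero.2 h)
          ((turn_mem_label_chain turn).2 rfl)
      · rw [(PMF.apply_eq_zero_iff _ t).2 hd, zero_mul]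
  -- A finite supremum bounded by half of itself is zero; no limit of powers of `1/2` is needed.
  have hM : ⨆ n, p (n + 1) ≤ 2⁻¹ * ⨆ n, p (n + 1) :=
    iSup_le fun n => (hp n).trans (mul_le_mul_right (le_iSup (fun n => p (n + 1)) (n + 1)) _)
  have htop : ⨆ n, p (n + 1) ≠ ∞ := ne_top_of_le_ne_top ENNReal.one_ne_top
    (iSup_le fun n => iSup_le fun σ => (chain turn).prob_le_one _ _ _ _)
  have h0 : ⨆ n, p (n + 1) = 0 := by
    by_contra h
    have := ENNReal.half_lt_self h htop
    rw [div_eq_mul_inv, mul_comm] at this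
    exact absurd hM (not_le.2 this)
  rintro ⟨σ, hσ⟩
  exact hσ.ne' (le_antisymm (((hle 1 σ).trans (le_iSup (fun n => p (n + 1)) 0)).trans_eq h0)
    zero_le)

theorem chain_sat : (chain turn).Sat (chain turn).posSem
    (neverTurn turn .existsPos) (true, 1) := by
  rw [sat_neverTurn]
  set B : Set (Bool × ℕ) := {t | turn ∉ (chain turn).label t} with hB
  let stay (k : ℕ) : Set (ℕ → Bool × ℕ) := ⋂ j, ⋂ (_ : j ≤ k), {ω | ω j ∈ B}
  have hmeas : ∀ k, MeasurableSet[playSpace (Bool × ℕ)] (stay k) := fun k =>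
    MeasurableSet.iInter fun j => MeasurableSet.iInter fun _ => measurableSet_eval j B
  have hmem : ∀ n, ((true, n + 1) : Bool × ℕ) ∈ B := fun n h =>
    absurd ((turn_mem_label_chain turn).1 h) (Nat.succ_ne_zero n)
  -- The bound does not depend on `k`, so it survives the limit by continuity from above. It ranges
  -- over `n` and `σ` because the first step changes both.
  have hstay : ∀ k n σ, survival n ≤
      (chain turn).prob (true, n + 1) σ (chain turn).natural (stay k) := by
    intro k
    induction k with
    | zero =>
      intro n σ
      rw [(chain turn).prob_eq_one]
      · exact_mod_cast survival_le_one n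
      · intro ω hω
        simpa [stay, hω.1] using hmem n
    | succ k ih =>
      intro n σ
      rw [prob_eq_tsum _ _ _ (hmeas _), nextState_chain]
      refine le_trans ?_ (ENNReal.le_tsum (true, n + 2))
      rw [trans_chain_succ]
      calc (survival n : ℝ≥0∞) = stepSurvival true n * survival (n + 1) := by
            rw [← ENNReal.coe_mul, stepSurvival, div_mul_cancel₀ _ (survival_pos _).ne']
        _ ≤ _ := by
            refine mul_le_mul_right ((ih (n + 1) _).trans (prob_mono _ _ _ _ fun ω hω => ?_)) _
            simp only [stay, Set.mem_preimage, Set.mem_iInter] at hω ⊢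
            rintro (_ | j) hj
            exacts [hmem n, hω j (by omega)]
  let σ : (chain turn).Strategy₁ := (chain turn).pureStrategy₁ (fun _ => ()) fun _ => trivial
  refine ⟨σ, ?_⟩
  let _ := playSpace (Bool × ℕ)
  have hprob := (chain turn).playMeasure_isProbabilityMeasure (true, 1) σ (chain turn).natural
  have hanti : Antitone stay := fun k l hkl ω hω => by
    simp only [stay, Set.mem_iInter] at hω ⊢
    exact fun j hj => hω j (hj.trans hkl)
  calc (0 : ℝ≥0∞) < survival 0 := by exact_mod_cast survival_pos 0
    _ ≤ ⨅ k, (chain turn).prob (true, 1) σ (chain turn).natural (stay k) :=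
      le_iInf fun k => hstay k 0 σ
    _ = (chain turn).prob (true, 1) σ (chain turn).natural (⋂ k, stay k) :=
      (hanti.measure_iInter (fun k => (hmeas k).nullMeasurableSet)
        ⟨0, MeasureTheory.measure_ne_top _ _⟩).symm
    _ ≤ _ := prob_mono _ _ _ _ fun ω hω => Or.inl fun j => by
      simp only [stay, Set.mem_iInter] at hω
      exact hω j j le_rfl

theorem chain_not_subset : ¬ (chain turn).atlEquiv ⊆ (chain turn).posEquiv := fun h =>
  chain_not_sat turn ((h ((chain_isATLBisimulation turn).mem_atlEquiv
    (chain_isFinitelyBranching turn) (s := (true, 1)) (t := (false, 1)) rfl) _).1 (chain_sat turn))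

end MDP

end

theorem mainTheorem6 {AP : Type*} (turn : AP) :
    (∀ {S A : Type*} [Finite S] (G : MDP AP S A), G.IsAlternating turn →
      G.atlEquiv ⊆ G.posEquiv) ∧
    (∃ (S A : Type) (G : MDP AP S A), Finite S ∧ ¬ G.IsAlternating turn ∧
      ¬ G.atlEquiv ⊆ G.posEquiv) ∧
    (∃ (S A : Type) (G : MDP AP S A), Infinite S ∧ G.IsFinitelyBranching ∧
      G.IsAlternating turn ∧ ¬ G.atlEquiv ⊆ G.posEquiv) :=
  ⟨fun G h => G.atlEquiv_subset_posEquiv h,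
    ⟨Fin 4, Fin 3, MDP.gadget turn, inferInstance, MDP.gadget_not_isAlternating turn,
      MDP.gadget_not_subset turn⟩,
    ⟨Bool × ℕ, Unit, MDP.chain turn, inferInstance, MDP.chain_isFinitelyBranching turn,
      MDP.chain_isAlternating turn, MDP.chain_not_subset turn⟩⟩
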